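/- A connected graph, equipped with the path metric giving each edge length one, is called hyperbolic if there is a constant $\delta$ such that all its geodesic triangles with corners at vertices are $\delta$-slim: each vertex on one side is within distance $\delta$ of the union of the other two sides. A group is hyperbolic if its Cayley graph with respect to some finite generating set is hyperbolic. A subgroup $H$ of a group $G$ is commensurated if for every $g\in G$ the intersection $H\cap gHg^{-1}$ has finite index in both $H$ and $gHg^{-1}$. For a finite generating set $S$ of $G$, the Cayley--Abels graph $\mathcal G(G,H,S)$ is the simplicial graph whose vertex set is the set $G/H$ of left cosets and whose edges are the pairs $\{gH,gsH\}$ with $g\in G$, $s\in S$ and $gH\neq gsH$. Let $G$ be a hyperbolic group and let $H\le G$ be a commensurated subgroup that is itself a hyperbolic group. Then for every finite generating set $S$ of $G$, the Cayley--Abels graph $\mathcal G(G,H,S)$ is (connected and) hyperbolic. -/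

import Mathlib

/-- `Γ` is `δ`-slim: in every geodesic triangle whose corners are vertices, every vertex on one side
is at combinatorial distance at most `δ` from a vertex on one of the other two sides.
The sides are walks that realise the combinatorial distance between their endpoints. -/
def SimpleGraph.HasSlimTriangles {V : Type*} (Γ : SimpleGraph V) (δ : ℕ) : Prop :=
  ∀ (x y z : V) (p : Γ.Walk x y) (q : Γ.Walk y z) (r : Γ.Walk z x),
    p.length = Γ.dist x y → q.length = Γ.dist y z → r.length = Γ.dist z x →
      ∀ v ∈ p.support, ∃ w, (w ∈ q.support ∨ w ∈ r.support) ∧ Γ.dist v w ≤ δ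

/-- A connected graph, with all edges of length one, is hyperbolic if it has uniformly slim
geodesic triangles. -/
def SimpleGraph.IsHyperbolic {V : Type*} (Γ : SimpleGraph V) : Prop :=
  Γ.Connected ∧ ∃ δ : ℕ, Γ.HasSlimTriangles δ

/-- A group is hyperbolic if it has a finite generating set whose Cayley graph is hyperbolic. -/
def IsHyperbolicGroup (G : Type*) [Group G] : Prop :=
  ∃ S : Set G, S.Finite ∧ Subgroup.closure S = ⊤ ∧ (SimpleGraph.mulCayley S).IsHyperbolic

/-- A subgroup `H` of `G` is commensurated if for every `g` in `G` the intersection of `H` and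
`g H g⁻¹` has finite index in both. -/
def Subgroup.IsCommensurated {G : Type*} [Group G] (H : Subgroup G) : Prop :=
  ∀ g : G, Subgroup.Commensurable (H.map (MulAut.conj g).toMonoidHom) H

/-- The Cayley–Abels graph of `(G, H)` with respect to `S`: the simple graph on the left cosets of
`H` whose edges join the distinct cosets among `gH` and `gsH`, for `g ∈ G` and `s ∈ S`. -/
def cayleyAbelsGraph {G : Type*} [Group G] (H : Subgroup G) (S : Set G) : SimpleGraph (G ⧸ H) :=
  SimpleGraph.fromRel fun a b => ∃ g : G, ∃ s ∈ S, a = (g : G ⧸ H) ∧ b = ((g * s : G) : G ⧸ H)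

/-! It suffices to find a section `σ` of `G → G ⧸ H` that is Lipschitz from the Cayley–Abels graph
to a Cayley graph of `G`. The quotient map is Lipschitz too, so the Cayley–Abels graph is then a
coarse Lipschitz retract of a hyperbolic graph. Images of geodesics form a slim family of paths, and
guessing geodesics gives hyperbolicity (`isHyperbolic_of_retract`).

Commensuration lets every `u` in `G` act coarsely on `H`: `u * h` can be corrected into `H` by a
right factor from a finite set. If `H` has arbitrarily large tripods centered at `1`, they are
transported to each coset, and `σ` picks a limit of their centers. For adjacent cosets the
transition map has uniform constants, since it comes from one of finitely many double cosets `H s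
H`. Transporting the corners along different routes gives an error that is not uniform, but centers
do not feel it once the corners are far enough (`hasBoundedSection_of_tripods`).

Without large tripods, `H` is finite and any section works, or it is infinite and coarsely the line
of powers of one loxodromic `t`. Then every `g` conjugates a power of `t` to a power of `t`, so it
stays near that line up to `H`. Thus `H` has finite index and again any section works. -/

namespace SimpleGraph

/-! ### Slim triangles, the four-point condition and centers. -/

variable {V : Type*} {Γ : SimpleGraph V}

/-- The map `γ` restricts to a geodesic on `{0, …, n}`. -/
def IsGeodesic (Γ : SimpleGraph V) (γ : ℕ → V) (n : ℕ) : Prop :=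
  ∀ i j, i ≤ j → j ≤ n → Γ.dist (γ i) (γ j) = j - i

/-- The four-point condition of Gromov. -/
def FourPoint (Γ : SimpleGraph V) (δ : ℕ) : Prop :=
  ∀ x y z w, Γ.dist x y + Γ.dist z w ≤ Γ.dist x z + Γ.dist y w + δ ∨
    Γ.dist x y + Γ.dist z w ≤ Γ.dist x w + Γ.dist y z + δ

theorem Connected.dist_le_length_sub (hc : Γ.Connected) {x y : V} (p : Γ.Walk x y) {i j : ℕ}
    (hij : i ≤ j) (hj : j ≤ p.length) : Γ.dist (p.getVert i) (p.getVert j) ≤ j - i := by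
  induction j, hij using Nat.le_induction with
  | base => simp
  | succ j hij ih =>
    have h1 := ih (by omega)
    have h2 := dist_eq_one_iff_adj.2 (p.adj_getVert_succ (i := j) (by omega))
    have h3 := hc.dist_triangle (u := p.getVert i) (v := p.getVert j) (w := p.getVert (j + 1))
    omega

theorem Connected.isGeodesic_getVert (hc : Γ.Connected) {x y : V} (p : Γ.Walk x y)
    (hp : p.length = Γ.dist x y) : Γ.IsGeodesic p.getVert (Γ.dist x y) := by
  intro i j hij hj
  have h1 := hc.dist_le_length_sub p hij (by omega)
  have h2 := hc.dist_le_length_sub p (Nat.zero_le i) (by omega)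
  have h3 := hc.dist_le_length_sub p (i := j) (j := p.length) (by omega) le_rfl
  have h4 := hc.dist_triangle (u := p.getVert 0) (v := p.getVert i) (w := p.getVert p.length)
  have h5 := hc.dist_triangle (u := p.getVert i) (v := p.getVert j) (w := p.getVert p.length)
  rw [p.getVert_zero, p.getVert_length] at *
  omega

theorem Connected.exists_isGeodesic (hc : Γ.Connected) (x y : V) :
    ∃ γ : ℕ → V, Γ.IsGeodesic γ (Γ.dist x y) ∧ γ 0 = x ∧ γ (Γ.dist x y) = y := by
  obtain ⟨p, hp⟩ := hc.exists_walk_length_eq_dist x y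
  refine ⟨p.getVert, hc.isGeodesic_getVert p hp, p.getVert_zero, ?_⟩
  rw [← hp, p.getVert_length]

theorem Connected.exists_between (hc : Γ.Connected) (x y : V) {i : ℕ} (hi : i ≤ Γ.dist x y) :
    ∃ p, Γ.dist x p = i ∧ Γ.dist p y = Γ.dist x y - i := by
  obtain ⟨γ, hγ, h0, h1⟩ := hc.exists_isGeodesic x y
  refine ⟨γ i, ?_, ?_⟩
  · rw [← h0, hγ 0 i (by omega) hi]; omega
  · nth_rw 1 [← h1]
    rw [hγ i _ hi le_rfl]

/-- A sequence of propositions covered by two alternatives switches from the first to the second. -/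
theorem exists_switch {P Q : ℕ → Prop} (n : ℕ) (h0 : P 0) (hn : Q n) (h : ∀ i ≤ n, P i ∨ Q i) :
    ∃ i ≤ n, Q i ∧ (P i ∨ ∃ j, i = j + 1 ∧ P j) := by
  classical
  have hex : ∃ i, Q i := ⟨n, hn⟩
  refine ⟨Nat.find hex, Nat.find_min' hex hn, Nat.find_spec hex, ?_⟩
  rcases hi : Nat.find hex with _ | j
  · exact Or.inl h0
  · have h1 : ¬ Q j := Nat.find_min hex (by omega)
    have h2 := Nat.find_min' hex hn
    exact Or.inr ⟨j, rfl, (h j (by omega)).resolve_right h1⟩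

/-- A vertex of a slim graph lying on a geodesic is near any two complementary sides. -/
theorem HasSlimTriangles.exists_near {δ : ℕ} (h : Γ.HasSlimTriangles δ) (hc : Γ.Connected)
    {x y p : V} (hp : Γ.dist x p + Γ.dist p y = Γ.dist x y) (z : V) :
    ∃ q, Γ.dist p q ≤ δ ∧ (Γ.dist x q + Γ.dist q z = Γ.dist x z ∨
      Γ.dist y q + Γ.dist q z = Γ.dist y z) := by
  obtain ⟨p₁, hp₁⟩ := hc.exists_walk_length_eq_dist x p
  obtain ⟨p₂, hp₂⟩ := hc.exists_walk_length_eq_dist p y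
  obtain ⟨q, hq⟩ := hc.exists_walk_length_eq_dist y z
  obtain ⟨r, hr⟩ := hc.exists_walk_length_eq_dist z x
  have key : ∀ {a b : V} (s : Γ.Walk a b), s.length = Γ.dist a b → ∀ w ∈ s.support,
      Γ.dist a w + Γ.dist w b = Γ.dist a b := by
    intro a b s hs w hw
    obtain ⟨i, rfl, hi⟩ := Walk.mem_support_iff_exists_getVert.1 hw
    have g := hc.isGeodesic_getVert s hs
    have g1 := g 0 i (by omega) (by omega)
    have g2 := g i _ (by omega) le_rfl
    rw [← hs, s.getVert_length] at g2
    rw [s.getVert_zero] at g1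
    omega
  obtain ⟨w, hw, hd⟩ := h x y z (p₁.append p₂) q r (by simp [hp₁, hp₂, hp]) hq hr p (by simp)
  refine ⟨w, hd, ?_⟩
  rcases hw with hw | hw
  · exact Or.inr (key q hq w hw)
  · left
    have := key r hr w hw
    rw [dist_comm (u := z) (v := w), dist_comm (u := w) (v := x), dist_comm (u := z) (v := x)] at this
    omega

/-- Walking from `x` to `y`, nearness to the side towards `x` switches to nearness to the side
towards `y`. The switch vertex is almost between `z` and both `x` and `y`, and almost between `w`
and one of them; compare distances through it. -/
theorem HasSlimTriangles.fourPoint {δ : ℕ} (h : Γ.HasSlimTriangles δ) (hc : Γ.Connected) :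
    Γ.FourPoint (4 * δ + 4) := by
  intro x y z w
  obtain ⟨γ, hγ, h0, h1⟩ := hc.exists_isGeodesic x y
  have hbet : ∀ i ≤ Γ.dist x y, Γ.dist x (γ i) + Γ.dist (γ i) y = Γ.dist x y := by
    intro i hi
    have g1 := hγ 0 i (by omega) hi
    have g2 := hγ i _ hi le_rfl
    rw [h0] at g1; rw [h1] at g2
    omega
  have tri := fun a b c => hc.dist_triangle (u := a) (v := b) (w := c)
  have comm := fun a b => Γ.dist_comm (u := a) (v := b)
  have hnear : ∀ i ≤ Γ.dist x y, ∀ z, Γ.dist x (γ i) + Γ.dist (γ i) z ≤ Γ.dist x z + 2 * δ ∨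
      Γ.dist y (γ i) + Γ.dist (γ i) z ≤ Γ.dist y z + 2 * δ := by
    intro i hi z
    obtain ⟨q, hq, h | h⟩ := h.exists_near hc (hbet i hi) z
    · left
      have := tri x q (γ i); have := tri (γ i) q z; have := comm q (γ i)
      omega
    · right
      have := tri y q (γ i); have := tri (γ i) q z; have := comm q (γ i)
      omega
  obtain ⟨i, hi, hQ, hP⟩ := exists_switch
    (P := fun i => Γ.dist x (γ i) + Γ.dist (γ i) z ≤ Γ.dist x z + 2 * δ)
    (Q := fun i => Γ.dist y (γ i) + Γ.dist (γ i) z ≤ Γ.dist y z + 2 * δ) (Γ.dist x y)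
    (by simp only [h0, dist_self]; omega) (by simp only [h1, dist_self]; omega)
    (fun i hi => hnear i hi z)
  have hP' : Γ.dist x (γ i) + Γ.dist (γ i) z ≤ Γ.dist x z + 2 * δ + 2 := by
    rcases hP with hP | ⟨j, rfl, hP⟩
    · omega
    · have g := hγ j (j + 1) (by omega) hi
      have := tri x (γ j) (γ (j + 1)); have := tri (γ (j + 1)) (γ j) z
      have := comm (γ j) (γ (j + 1))
      omega
  have hb := hbet i hi
  have := tri z (γ i) w; have := comm z (γ i); have := comm (γ i) y
  rcases hnear i hi w with hw | hw
  · right; omega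
  · left; omega

variable {δ : ℕ}

/-- Under the four-point condition, a vertex almost between `x` and `y` is near every vertex of a
geodesic at the same distance from `x`. -/
theorem FourPoint.dist_le_of_between (h : Γ.FourPoint δ) {x y p q : V} {κ : ℕ}
    (hp : Γ.dist x p + Γ.dist p y ≤ Γ.dist x y + κ) (hq : Γ.dist x q + Γ.dist q y = Γ.dist x y)
    (hpq : Γ.dist x q ≤ Γ.dist x p) (hpq' : Γ.dist x p ≤ Γ.dist x q + κ) :
    Γ.dist p q ≤ 2 * κ + δ := by
  have := h x y p q
  have := Γ.dist_comm (u := y) (v := p); have := Γ.dist_comm (u := y) (v := q)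
  omega

theorem FourPoint.exists_geodesic_near (h : Γ.FourPoint δ) {γ : ℕ → V} {n : ℕ}
    (hγ : Γ.IsGeodesic γ n) {p : V} {κ : ℕ}
    (hp : Γ.dist (γ 0) p + Γ.dist p (γ n) ≤ Γ.dist (γ 0) (γ n) + κ) :
    ∃ i ≤ n, Γ.dist p (γ i) ≤ 2 * κ + δ := by
  have hn := hγ 0 n (by omega) le_rfl
  have g1 := hγ 0 (min n (Γ.dist (γ 0) p)) (by omega) (by omega)
  have g2 := hγ (min n (Γ.dist (γ 0) p)) n (by omega) (by omega)
  exact ⟨min n (Γ.dist (γ 0) p), by omega, h.dist_le_of_between hp (by omega) (by omega) (by omega)⟩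

/-- One of the two Gromov products is small. -/
theorem FourPoint.between_or (h : Γ.FourPoint δ) {x y p : V} {κ : ℕ}
    (hp : Γ.dist x p + Γ.dist p y ≤ Γ.dist x y + κ) (z : V) :
    Γ.dist x p + Γ.dist p z ≤ Γ.dist x z + κ + δ ∨
      Γ.dist z p + Γ.dist p y ≤ Γ.dist z y + κ + δ := by
  have := h x y p z
  have := Γ.dist_comm (u := y) (v := p); have := Γ.dist_comm (u := y) (v := z)
  have := Γ.dist_comm (u := z) (v := p)
  omega

theorem FourPoint.exists_near (h : Γ.FourPoint δ) (hc : Γ.Connected) {x y p : V}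
    (hp : Γ.dist x p + Γ.dist p y = Γ.dist x y) (z : V) :
    ∃ q, Γ.dist p q ≤ 3 * δ ∧ (Γ.dist x q + Γ.dist q z = Γ.dist x z ∨
      Γ.dist z q + Γ.dist q y = Γ.dist z y) := by
  have key : ∀ a b, Γ.dist a p + Γ.dist p b ≤ Γ.dist a b + δ →
      ∃ q, Γ.dist p q ≤ 3 * δ ∧ Γ.dist a q + Γ.dist q b = Γ.dist a b := by
    intro a b hab
    obtain ⟨γ, hγ, h0, h1⟩ := hc.exists_isGeodesic a b
    obtain ⟨i, hi, hd⟩ := h.exists_geodesic_near hγ (p := p) (κ := δ) (by rw [h0, h1]; exact hab)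
    refine ⟨γ i, by omega, ?_⟩
    have g1 := hγ 0 i (by omega) hi
    have g2 := hγ i _ hi le_rfl
    rw [h0] at g1; rw [h1] at g2
    omega
  rcases h.between_or (x := x) (y := y) (p := p) (κ := 0) (by omega) z with hz | hz
  · obtain ⟨q, hq, hq'⟩ := key x z (by omega)
    exact ⟨q, hq, Or.inl hq'⟩
  · obtain ⟨q, hq, hq'⟩ := key z y (by omega)
    exact ⟨q, hq, Or.inr hq'⟩

/-- `m` is a `κ`-center of the triangle `x y z`: it is almost between any two corners. -/
def IsCenter (Γ : SimpleGraph V) (κ : ℕ) (m x y z : V) : Prop :=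
  Γ.dist x m + Γ.dist m y ≤ Γ.dist x y + κ ∧ Γ.dist y m + Γ.dist m z ≤ Γ.dist y z + κ ∧
    Γ.dist x m + Γ.dist m z ≤ Γ.dist x z + κ

theorem FourPoint.exists_isCenter (h : Γ.FourPoint δ) (hc : Γ.Connected) (x y z : V) :
    ∃ m, Γ.IsCenter (δ + 2) m x y z := by
  obtain ⟨γ, hγ, h0, h1⟩ := hc.exists_isGeodesic x y
  have tri := fun a b c => hc.dist_triangle (u := a) (v := b) (w := c)
  have comm := fun a b => Γ.dist_comm (u := a) (v := b)
  have hbet : ∀ i ≤ Γ.dist x y, Γ.dist x (γ i) + Γ.dist (γ i) y = Γ.dist x y := by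
    intro i hi
    have g1 := hγ 0 i (by omega) hi
    have g2 := hγ i _ hi le_rfl
    rw [h0] at g1; rw [h1] at g2
    omega
  obtain ⟨i, hi, hQ, hP⟩ := exists_switch
    (P := fun i => Γ.dist x (γ i) + Γ.dist (γ i) z ≤ Γ.dist x z + δ)
    (Q := fun i => Γ.dist z (γ i) + Γ.dist (γ i) y ≤ Γ.dist z y + δ) (Γ.dist x y)
    (by simp only [h0, dist_self]; omega) (by simp only [h1, dist_self]; omega)
    (fun i hi => by
      have := h.between_or (κ := 0) (by rw [hbet i hi]; rfl) z
      simpa using this)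
  have hP' : Γ.dist x (γ i) + Γ.dist (γ i) z ≤ Γ.dist x z + δ + 2 := by
    rcases hP with hP | ⟨j, rfl, hP⟩
    · omega
    · have g := hγ j (j + 1) (by omega) hi
      have := tri x (γ j) (γ (j + 1)); have := tri (γ (j + 1)) (γ j) z
      have := comm (γ j) (γ (j + 1))
      omega
  have := hbet i hi
  have := comm (γ i) z; have := comm (γ i) y; have := comm y z
  exact ⟨γ i, by omega, by omega, by omega⟩

/-- If `m` and `m'` were far apart, the four-point condition would force `dist · m' - dist · m` to
have opposite signs at any two corners, which is impossible for three corners. -/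
theorem FourPoint.dist_centers_le (h : Γ.FourPoint δ) {κ : ℕ}
    {m m' x y z : V} (hm : Γ.IsCenter κ m x y z) (hm' : Γ.IsCenter κ m' x y z) :
    Γ.dist m m' ≤ 2 * κ + δ := by
  obtain ⟨a1, a2, a3⟩ := hm
  obtain ⟨b1, b2, b3⟩ := hm'
  have comm := fun a b => Γ.dist_comm (u := a) (v := b)
  have := comm x m; have := comm y m; have := comm z m
  have := comm x m'; have := comm y m'; have := comm z m'
  have := h x y m m'; have := h y z m m'; have := h x z m m'
  omega

/-- Centers persist when distant corners are moved a little. -/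
theorem FourPoint.isCenter_of_dist_le (h : Γ.FourPoint δ) (hc : Γ.Connected) {κ K : ℕ}
    {m x y z x' y' z' : V} (hm : Γ.IsCenter κ m x y z)
    (hx : Γ.dist x x' ≤ K) (hy : Γ.dist y y' ≤ K) (hz : Γ.dist z z' ≤ K)
    (lx : 2 * K + κ + 2 * δ < Γ.dist m x) (ly : 2 * K + κ + 2 * δ < Γ.dist m y)
    (lz : 2 * K + κ + 2 * δ < Γ.dist m z) : Γ.IsCenter (κ + 2 * δ) m x' y' z' := by
  have comm := fun a b => Γ.dist_comm (u := a) (v := b)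
  have tri := fun a b c => hc.dist_triangle (u := a) (v := b) (w := c)
  have key : ∀ a b a' b', Γ.dist a m + Γ.dist m b ≤ Γ.dist a b + κ → Γ.dist a a' ≤ K →
      Γ.dist b b' ≤ K → 2 * K + κ + 2 * δ < Γ.dist m a → 2 * K + κ + 2 * δ < Γ.dist m b →
      Γ.dist a' m + Γ.dist m b' ≤ Γ.dist a' b' + (κ + 2 * δ) := by
    intro a b a' b' hab ha hb la lb
    have := h m a' a b'; have := h m b' b a
    have := comm m a; have := comm m b; have := comm m a'; have := comm m b'
    have := comm a a'; have := comm b b'; have := comm a b; have := comm a' b'; have := comm a b'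
    have := tri a a' m; have := tri b b' m
    omega
  obtain ⟨a1, a2, a3⟩ := hm
  exact ⟨key _ _ _ _ a1 hx hy lx ly, key _ _ _ _ a2 hy hz ly lz, key _ _ _ _ a3 hx hz lx lz⟩

end SimpleGraph

/-! ### Guessing geodesics and coarse Lipschitz retracts. -/

namespace SimpleGraph

variable {V W : Type*} {Γ : SimpleGraph V} {Λ : SimpleGraph W}

theorem IsGeodesic.shift {γ : ℕ → V} {n : ℕ} (hγ : Γ.IsGeodesic γ n) {a m : ℕ} (h : a + m ≤ n) :
    Γ.IsGeodesic (fun i => γ (a + i)) m := by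
  intro i j hij hj
  have := hγ (a + i) (a + j) (by omega) (by omega)
  simp only [this]
  omega

/-- A family of sets `A x y` that is small for adjacent `x y` and satisfies a slim triangle
condition with constant `h`. -/
structure IsSlimFamily (Γ : SimpleGraph V) (A : V → V → Set V) (h : ℕ) : Prop where
  small : ∀ x y, Γ.dist x y ≤ 1 → ∀ p ∈ A x y, Γ.dist p x ≤ h
  slim : ∀ x y z, ∀ p ∈ A x y, ∃ q, Γ.dist p q ≤ h ∧ (q ∈ A x z ∨ q ∈ A z y)

/-- Bisecting the geodesic costs `h` each time. This logarithmic bound is what the uniform constant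
is bootstrapped from. -/
theorem IsSlimFamily.exists_dist_le_log {A : V → V → Set V} {h : ℕ} (hA : Γ.IsSlimFamily A h)
    (hc : Γ.Connected) (k : ℕ) : ∀ (γ : ℕ → V) (n : ℕ), Γ.IsGeodesic γ n → n ≤ 2 ^ k →
      ∀ p ∈ A (γ 0) (γ n), ∃ i ≤ n, Γ.dist p (γ i) ≤ (k + 1) * h := by
  induction k with
  | zero =>
    intro γ n hγ hn p hp
    have := hγ 0 n (by omega) le_rfl
    exact ⟨0, by omega, by simpa using hA.small _ _ (by rw [this]; simpa using hn) p hp⟩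
  | succ k ih =>
    intro γ n hγ hn p hp
    rw [pow_succ] at hn
    obtain ⟨q, hq, hqA⟩ := hA.slim _ _ (γ (min n (2 ^ k))) p hp
    have hm : min n (2 ^ k) + (n - min n (2 ^ k)) = n := by omega
    suffices H : ∃ i ≤ n, Γ.dist q (γ i) ≤ (k + 1) * h by
      obtain ⟨i, hi, hd⟩ := H
      have := hc.dist_triangle (u := p) (v := q) (w := γ i)
      exact ⟨i, hi, by linarith⟩
    rcases hqA with hqA | hqA
    · obtain ⟨i, hi, hd⟩ := ih γ (min n (2 ^ k)) (fun i j hij hj => hγ i j hij (by omega))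
        (by omega) q hqA
      exact ⟨i, by omega, hd⟩
    · obtain ⟨i, hi, hd⟩ := ih (fun i => γ (min n (2 ^ k) + i)) (n - min n (2 ^ k))
        (hγ.shift (by omega)) (by omega) q (by simpa [hm] using hqA)
      exact ⟨_, by omega, hd⟩

/-- Guessing geodesics: the members of a slim family are uniformly close to geodesics. -/
theorem exists_guessing_constant (h : ℕ) : ∃ C, ∀ {V : Type*} {Γ : SimpleGraph V}
    {A : V → V → Set V}, Γ.Connected → Γ.IsSlimFamily A h → ∀ (n : ℕ) (γ : ℕ → V),
      Γ.IsGeodesic γ n → ∀ p ∈ A (γ 0) (γ n), ∃ i ≤ n, Γ.dist p (γ i) ≤ C := by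
  -- The window of length `2 * R` used below must fit into `2 ^ k`, while `C` allows for `k`
  -- bisections on it and two slim steps.
  obtain ⟨k, hk⟩ : ∃ k, 4 * ((k + 3) * h) + 8 * h + 2 ≤ 2 ^ k := by
    have h1 : ∀ k, k ≤ 2 ^ k := fun k => Nat.lt_two_pow_self.le
    refine ⟨2 * (20 * h + 2) , ?_⟩
    have h2 := h1 (20 * h + 2)
    have h3 : 2 ^ (2 * (20 * h + 2)) = 2 ^ (20 * h + 2) * 2 ^ (20 * h + 2) := by
      rw [two_mul, pow_add]
    rw [h3]
    have h4 := Nat.mul_le_mul h2 h2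
    nlinarith
  obtain ⟨C, hC⟩ : ∃ C, C = (k + 3) * h := ⟨_, rfl⟩
  rw [← hC] at hk
  have hC3 : 3 * h ≤ C := by rw [hC]; nlinarith
  have hC' : (k + 1) * h + 2 * h = C := by rw [hC]; ring
  refine ⟨C, ?_⟩
  intro V Γ A hc hA n
  induction n using Nat.strong_induction_on with
  | _ n ih =>
  intro γ hγ p hp
  by_contra! hfar
  have tri := fun a b c => hc.dist_triangle (u := a) (v := b) (w := c)
  have comm := fun a b => Γ.dist_comm (u := a) (v := b)
  -- `γ w` is the point of the geodesic nearest to `p`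
  obtain ⟨w, hw, hmin⟩ : ∃ w ≤ n, ∀ i ≤ n, Γ.dist p (γ w) ≤ Γ.dist p (γ i) := by
    obtain ⟨w, hw, hmin⟩ := Finset.exists_min_image (Finset.range (n + 1))
      (fun i => Γ.dist p (γ i)) ⟨0, by simp⟩
    exact ⟨w, by simpa [Nat.lt_succ_iff] using hw, fun i hi => hmin i (by simp; omega)⟩
  -- `R` exceeds `2 * (C + 2 * h)`: a point within `2 * h` of `p` cannot be `C`-close to the
  -- geodesic at distance `R` from the nearest point `γ w`. So induction excludes the parts outside
  -- the window, and the logarithmic bound handles the window itself.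
  obtain ⟨R, hR⟩ : ∃ R, R = 2 * C + 4 * h + 1 := ⟨_, rfl⟩
  obtain ⟨a, ha⟩ : ∃ a, a = w - R := ⟨_, rfl⟩
  obtain ⟨b, hb⟩ : ∃ b, b = min n (w + R) := ⟨_, rfl⟩
  have hsmall : ∀ i ≤ n, ∀ q ∈ A (γ i) (γ i), Γ.dist q (γ i) ≤ h := fun i hi q hq =>
    hA.small _ _ (by simp) q hq
  -- points close to the geodesic but far from `γ w` along it are impossible
  have hcontra : ∀ q, Γ.dist p q ≤ 2 * h → ∀ u ≤ n, R ≤ u - w ∨ R ≤ w - u →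
      Γ.dist q (γ u) ≤ C → False := by
    intro q hq u hu hRu hqu
    have h1 := hmin u hu
    have h2 := tri p q (γ u)
    have h3 := tri (γ w) p (γ u)
    have h4 := comm (γ w) p
    rcases hRu with hRu | hRu
    · have := hγ w u (by omega) hu; omega
    · have := hγ u w (by omega) hw; have := comm (γ u) (γ w); omega
  obtain ⟨q, hq, hqA | hqA⟩ := hA.slim _ _ (γ a) p hp
  · by_cases ha0 : a = 0
    · rw [ha0] at hqA
      have h1 := hsmall 0 (by omega) q hqA
      have := hfar 0 (by omega); have := tri p q (γ 0); omega
    · obtain ⟨u, hu, hd⟩ := ih a (by omega) γ (fun i j hij hj => hγ i j hij (by omega)) q hqA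
      exact hcontra q (by omega) u (by omega) (Or.inr (by omega)) hd
  · obtain ⟨q', hq', hqA'⟩ := hA.slim _ _ (γ b) q hqA
    have hpq' := tri p q q'
    rcases hqA' with hqA' | hqA'
    · obtain ⟨i, hi, hd⟩ := hA.exists_dist_le_log hc k (fun i => γ (a + i)) (b - a)
        (hγ.shift (by omega)) (by omega) q' (by simpa [show a + (b - a) = b by omega] using hqA')
      have := hfar (a + i) (by omega)
      have := tri p q' (γ (a + i))
      omega
    · by_cases hbn : b = n
      · rw [hbn] at hqA'
        have h1 := hsmall n le_rfl q' hqA'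
        have := hfar n le_rfl; have := tri p q' (γ n); omega
      · obtain ⟨u, hu, hd⟩ := ih (n - b) (by omega) (fun i => γ (b + i))
          (hγ.shift (by omega)) q' (by simpa [show b + (n - b) = n by omega] using hqA')
        exact hcontra q' (by omega) (b + u) (by omega) (Or.inl (by omega)) hd

/-- A map between graphs sending adjacent vertices to vertices at distance at most `L`. -/
def LipschitzOnEdges (Γ : SimpleGraph V) (Λ : SimpleGraph W) (L : ℕ) (f : V → W) : Prop :=
  ∀ x y, Γ.dist x y ≤ 1 → Λ.dist (f x) (f y) ≤ L

theorem LipschitzOnEdges.dist_le {L : ℕ} {f : V → W} (hf : LipschitzOnEdges Γ Λ L f)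
    (hc : Γ.Connected) (hc' : Λ.Connected) (x y : V) :
    Λ.dist (f x) (f y) ≤ L * Γ.dist x y := by
  obtain ⟨γ, hγ, h0, h1⟩ := hc.exists_isGeodesic x y
  suffices H : ∀ i ≤ Γ.dist x y, Λ.dist (f x) (f (γ i)) ≤ L * i by
    simpa [h1] using H _ le_rfl
  intro i
  induction i with
  | zero => simp [h0]
  | succ i ih =>
    intro hi
    have := ih (by omega)
    have := hf (γ i) (γ (i + 1)) (by rw [hγ i (i + 1) (by omega) hi]; omega)
    have := hc'.dist_triangle (u := f x) (v := f (γ i)) (w := f (γ (i + 1)))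
    rw [mul_add]; omega

/-- Images of geodesic intervals of a hyperbolic graph under a coarse Lipschitz retraction. -/
theorem isSlimFamily_image {δ L : ℕ} (h : Γ.FourPoint δ) (hc : Γ.Connected) (hc' : Λ.Connected)
    {f : V → W} {g : W → V} (hf : LipschitzOnEdges Γ Λ L f) (hg : LipschitzOnEdges Λ Γ L g)
    (hfg : ∀ y, Λ.dist (f (g y)) y ≤ L) :
    Λ.IsSlimFamily (fun x y => f '' {p | Γ.dist (g x) p + Γ.dist p (g y) = Γ.dist (g x) (g y)})
      (L * L + L + L * (3 * δ)) where
  small := by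
    rintro x y hxy _ ⟨p, hp, rfl⟩
    simp only [Set.mem_ofPred_eq] at hp
    have h1 := hg x y hxy
    have h2 := hf.dist_le hc hc' (g x) p
    have h3 := hc'.dist_triangle (u := f p) (v := f (g x)) (w := x)
    have h4 := hfg x
    have h5 : L * Γ.dist (g x) p ≤ L * L := Nat.mul_le_mul_left _ (by omega)
    have h6 := Λ.dist_comm (u := f p) (v := f (g x))
    omega
  slim := by
    rintro x y z _ ⟨p, hp, rfl⟩
    obtain ⟨q, hq, hq'⟩ := h.exists_near hc hp (g z)
    have h2 := hf.dist_le hc hc' p q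
    have h5 : L * Γ.dist p q ≤ L * (3 * δ) := Nat.mul_le_mul_left _ hq
    refine ⟨f q, by omega, ?_⟩
    rcases hq' with hq' | hq'
    · exact Or.inl ⟨q, hq', rfl⟩
    · exact Or.inr ⟨q, hq', rfl⟩

/-- Quasi-isometries of a hyperbolic graph onto a graph approximately preserve betweenness. -/
theorem exists_between_constant (δ L κ : ℕ) : ∃ C, ∀ {V W : Type*} {Γ : SimpleGraph V}
    {Λ : SimpleGraph W} {f : V → W} {g : W → V}, Γ.FourPoint δ → Γ.Connected → Λ.Connected →
      LipschitzOnEdges Γ Λ L f → LipschitzOnEdges Λ Γ L g → (∀ y, Λ.dist (f (g y)) y ≤ L) →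
      ∀ x y p, Γ.dist (g x) p + Γ.dist p (g y) ≤ Γ.dist (g x) (g y) + κ →
        Λ.dist x (f p) + Λ.dist (f p) y ≤ Λ.dist x y + C := by
  obtain ⟨C, hC⟩ := exists_guessing_constant (L * L + L + L * (3 * δ))
  refine ⟨2 * (C + L * (2 * κ + δ)), ?_⟩
  intro V W Γ Λ f g h hc hc' hf hg hfg x y p hp
  obtain ⟨γ, hγ, h0, h1⟩ := hc'.exists_isGeodesic x y
  obtain ⟨η, hη, e0, e1⟩ := hc.exists_isGeodesic (g x) (g y)
  obtain ⟨j, hj, hpj⟩ := h.exists_geodesic_near hη (p := p) (κ := κ) (by rw [e0, e1]; exact hp)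
  have g1 := hη 0 j (by omega) hj
  have g2 := hη j _ hj le_rfl
  rw [e0] at g1; rw [e1] at g2
  obtain ⟨i, hi, hd⟩ := hC hc' (isSlimFamily_image h hc hc' hf hg hfg) _ γ hγ (f (η j))
    (by rw [h0, h1]; exact ⟨η j, by simp only [Set.mem_ofPred_eq]; omega, rfl⟩)
  have k1 := hγ 0 i (by omega) hi
  have k2 := hγ i _ hi le_rfl
  rw [h0] at k1; rw [h1] at k2
  have h2 := hf.dist_le hc hc' p (η j)
  have h5 : L * Γ.dist p (η j) ≤ L * (2 * κ + δ) := Nat.mul_le_mul_left _ hpj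
  have := hc'.dist_triangle (u := f p) (v := f (η j)) (w := γ i)
  have := hc'.dist_triangle (u := f p) (v := γ i) (w := y)
  have := hc'.dist_triangle (u := x) (v := γ i) (w := f p)
  have := Λ.dist_comm (u := γ i) (v := f p)
  omega

/-- A coarse Lipschitz retract of a hyperbolic graph is hyperbolic. -/
theorem isHyperbolic_of_retract {δ L : ℕ} {f : V → W} {g : W → V} (h : Γ.FourPoint δ)
    (hc : Γ.Connected) (hc' : Λ.Connected) (hf : LipschitzOnEdges Γ Λ L f)
    (hg : LipschitzOnEdges Λ Γ L g) (hfg : ∀ y, Λ.dist (f (g y)) y ≤ L) : Λ.IsHyperbolic := by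
  obtain ⟨C, hC⟩ := exists_guessing_constant (L * L + L + L * (3 * δ))
  have hA := isSlimFamily_image h hc hc' hf hg hfg
  have tri := fun a b c => hc'.dist_triangle (u := a) (v := b) (w := c)
  have comm := fun a b => Λ.dist_comm (u := a) (v := b)
  have hnear : ∀ {x y : W} (s : Λ.Walk x y), s.length = Λ.dist x y → ∀ p,
      Γ.dist (g x) p + Γ.dist p (g y) = Γ.dist (g x) (g y) →
      ∃ i ≤ s.length, Λ.dist (f p) (s.getVert i) ≤ C := by
    intro x y s hs p hp
    rw [hs]
    refine hC hc' hA _ _ (hc'.isGeodesic_getVert s hs) (f p) ?_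
    rw [← hs, s.getVert_zero, s.getVert_length]
    exact ⟨p, hp, rfl⟩
  refine ⟨hc', 4 * C + 2 * L + L * (3 * δ) + 2 * L, ?_⟩
  intro x y z s q r hs hq hr v hv
  obtain ⟨j, rfl, hj⟩ := Walk.mem_support_iff_exists_getVert.1 hv
  obtain ⟨η, hη, e0, e1⟩ := hc.exists_isGeodesic (g x) (g y)
  have hbet : ∀ i ≤ Γ.dist (g x) (g y),
      Γ.dist (g x) (η i) + Γ.dist (η i) (g y) = Γ.dist (g x) (g y) := by
    intro i hi
    have g1 := hη 0 i (by omega) hi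
    have g2 := hη i _ hi le_rfl
    rw [e0] at g1; rw [e1] at g2
    omega
  have hgeo := hc'.isGeodesic_getVert s hs
  rw [← hs] at hgeo
  -- Guessing only puts the image path near the geodesic. Conversely, some `f (η i)` is close to `s`
  -- both before and after `j`, and this squeezes `s.getVert j` near it.
  obtain ⟨i, hi, ⟨b, hjb, hb, hbd⟩, hP⟩ := exists_switch
    (P := fun i => ∃ a ≤ j, Λ.dist (f (η i)) (s.getVert a) ≤ C + L)
    (Q := fun i => ∃ b, j ≤ b ∧ b ≤ s.length ∧ Λ.dist (f (η i)) (s.getVert b) ≤ C + L)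
    (Γ.dist (g x) (g y))
    ⟨0, by omega, by rw [e0, s.getVert_zero]; have := hfg x; omega⟩
    ⟨s.length, hj, le_rfl, by rw [e1, s.getVert_length]; have := hfg y; omega⟩
    (fun i hi => by
      obtain ⟨a, ha, had⟩ := hnear s hs (η i) (hbet i hi)
      rcases le_total a j with haj | haj
      · exact Or.inl ⟨a, haj, by omega⟩
      · exact Or.inr ⟨a, haj, ha, by omega⟩)
  have hP' : ∃ a ≤ j, Λ.dist (f (η i)) (s.getVert a) ≤ C + 2 * L := by
    rcases hP with ⟨a, ha, had⟩ | ⟨i', rfl, a, ha, had⟩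
    · exact ⟨a, ha, by omega⟩
    · refine ⟨a, ha, ?_⟩
      have := hf (η i') (η (i' + 1)) (by rw [hη i' (i' + 1) (by omega) hi]; omega)
      have := tri (f (η (i' + 1))) (f (η i')) (s.getVert a)
      have := comm (f (η (i' + 1))) (f (η i'))
      omega
  obtain ⟨a, ha, had⟩ := hP'
  have hv : Λ.dist (s.getVert j) (f (η i)) ≤ 3 * C + 4 * L := by
    have := hgeo a b (by omega) hb
    have := hgeo j b hjb hb
    have := tri (s.getVert a) (f (η i)) (s.getVert b)
    have := tri (s.getVert j) (s.getVert b) (f (η i))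
    have := comm (f (η i)) (s.getVert a); have := comm (f (η i)) (s.getVert b)
    omega
  obtain ⟨p, hp, hp'⟩ := h.exists_near hc (hbet i hi) (g z)
  have h2 := hf.dist_le hc hc' (η i) p
  have h5 : L * Γ.dist (η i) p ≤ L * (3 * δ) := Nat.mul_le_mul_left _ hp
  have := tri (s.getVert j) (f (η i)) (f p)
  rcases hp' with hp' | hp'
  · obtain ⟨k, hk, hd⟩ := hnear r hr p (by
      rw [Γ.dist_comm (u := g z), Γ.dist_comm (v := g x), Γ.dist_comm (u := g z)]; omega)
    refine ⟨r.getVert k, Or.inr (r.getVert_mem_support k), ?_⟩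
    have := tri (s.getVert j) (f p) (r.getVert k)
    omega
  · obtain ⟨k, hk, hd⟩ := hnear q hq p (by
      rw [Γ.dist_comm (u := g y), Γ.dist_comm (v := g z), Γ.dist_comm (u := g y)]; omega)
    refine ⟨q.getVert k, Or.inl (q.getVert_mem_support k), ?_⟩
    have := tri (s.getVert j) (f p) (q.getVert k)
    omega

end SimpleGraph

/-! ### Word length in Cayley graphs. -/

namespace SimpleGraph

variable {G : Type*} [Group G] {S : Set G}

theorem dist_mulCayley_mul_left (g x y : G) :
    (mulCayley S).dist (g * x) (g * y) = (mulCayley S).dist x y := by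
  let e : mulCayley S ≃g mulCayley S :=
    { Equiv.mulLeft g with map_rel_iff' := by intro a b; simp }
  have h : ∀ x y, Nonempty ((mulCayley S).Walk x y) → ∀ f : mulCayley S ≃g mulCayley S,
      (mulCayley S).dist (f x) (f y) ≤ (mulCayley S).dist x y := by
    intro x y hxy f
    obtain ⟨p, hp⟩ := Reachable.exists_walk_length_eq_dist hxy
    rw [← hp, ← p.length_map f.toHom]
    exact dist_le _
  by_cases hxy : (mulCayley S).Reachable x y
  · refine le_antisymm (h x y hxy e) ?_
    simpa [e] using h (g * x) (g * y) (hxy.map e.toHom) e.symm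
  · rw [dist_eq_zero_of_not_reachable hxy, dist_eq_zero_of_not_reachable]
    intro h'
    exact hxy (by simpa [e] using h'.map e.symm.toHom)

/-- The word length with respect to `S`. -/
noncomputable def wordLength (S : Set G) (g : G) : ℕ := (mulCayley S).dist 1 g

theorem dist_mulCayley (x y : G) : (mulCayley S).dist x y = wordLength S (x⁻¹ * y) := by
  rw [wordLength, ← dist_mulCayley_mul_left x⁻¹ x y, inv_mul_cancel]

@[simp] theorem wordLength_one : wordLength S (1 : G) = 0 := by simp [wordLength]

@[simp] theorem wordLength_inv (g : G) : wordLength S g⁻¹ = wordLength S g := by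
  have := dist_mulCayley (S := S) g 1
  rw [mul_one] at this
  rw [← this, dist_comm, wordLength]

theorem wordLength_mul_le (hc : (mulCayley S).Connected) (g h : G) :
    wordLength S (g * h) ≤ wordLength S g + wordLength S h := by
  have := hc.dist_triangle (u := 1) (v := g) (w := g * h)
  rw [dist_mulCayley g, inv_mul_cancel_left] at this
  exact this

theorem finite_wordLength_le (hS : S.Finite) (hc : (mulCayley S).Connected) (n : ℕ) :
    {g : G | wordLength S g ≤ n}.Finite := by
  induction n with
  | zero =>
    refine (Set.finite_singleton (1 : G)).subset ?_
    intro g hg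
    have : (mulCayley S).dist 1 g = 0 := Nat.le_zero.1 hg
    exact ((hc.dist_eq_zero_iff).1 this).symm
  | succ n ih =>
    refine (ih.union ((ih.mul hS).union (ih.mul hS.inv))).subset ?_
    intro g hg
    rcases Nat.lt_or_ge (wordLength S g) (n + 1) with hlt | hge
    · exact Or.inl (Nat.lt_succ_iff.1 hlt)
    have hg' : (mulCayley S).dist 1 g = n + 1 := le_antisymm hg hge
    obtain ⟨p, hp1, hp2⟩ := hc.exists_between 1 g (i := n) (by omega)
    rw [hg', Nat.add_sub_cancel_left, dist_eq_one_iff_adj, mulCayley_adj] at hp2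
    rcases hp2.2 with h | h
    · exact Or.inr (Or.inl ⟨p, hp1.le, _, h, by simp⟩)
    · exact Or.inr (Or.inr ⟨p, hp1.le, _, Set.inv_mem_inv.2 h, by simp⟩)

/-- The four-point condition in terms of word lengths, with one of the points the identity. -/
theorem FourPoint.left_one {δ : ℕ} (h : (mulCayley S).FourPoint δ) (x y z : G) :
    wordLength S x + wordLength S (y⁻¹ * z) ≤
        wordLength S y + wordLength S (x⁻¹ * z) + δ ∨
      wordLength S x + wordLength S (y⁻¹ * z) ≤
        wordLength S z + wordLength S (x⁻¹ * y) + δ := by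
  have := h 1 x y z
  simpa [dist_mulCayley] using this

end SimpleGraph

/-- Repeated squaring doubles a gain while adding only a constant cost; this makes the two growth
rates contradictory. -/
theorem Nat.exists_add_mul_lt_two_pow (a c : ℕ) : ∃ i, a + i * c < 2 ^ i := by
  refine ⟨2 * (a + 2 * c), ?_⟩
  have h : a + 2 * c < 2 ^ (a + 2 * c) := Nat.lt_two_pow_self
  rw [two_mul (a + 2 * c), pow_add]
  nlinarith [Nat.mul_le_mul h h]

namespace SimpleGraph

variable {G : Type*} [Group G] {S : Set G} {δ : ℕ}

/-! ### Subgroups whose elements do not stretch under squaring. -/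

section NotLoxodromic

variable {H : Subgroup G} {c : ℕ}

/-- Since neither `g` nor `j * g` stretches, geodesics from `1` to these elements and their inverses
share about half their length. This saves one `wordLength S g` over the triangle inequality. -/
theorem FourPoint.wordLength_conj_le (h : (mulCayley S).FourPoint δ)
    (hc : (mulCayley S).Connected) (hH : ∀ g ∈ H, wordLength S (g * g) ≤ wordLength S g + c)
    {j g : G} (hj : j ∈ H) (hg : g ∈ H) :
    wordLength S (g⁻¹ * (j * g)) ≤ wordLength S g + wordLength S j + c + 2 * δ := by
  have h1 := h.left_one g⁻¹ g (g⁻¹ * j⁻¹)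
  have h2 := h.left_one (g⁻¹ * j⁻¹) g (j * g)
  have e1 : (g⁻¹)⁻¹ * g = g * g := by group
  have e2 : (g⁻¹)⁻¹ * (g⁻¹ * j⁻¹) = j⁻¹ := by group
  have e3 : (g⁻¹ * j⁻¹)⁻¹ * (j * g) = (j * g) * (j * g) := by group
  have e4 : wordLength S (g⁻¹ * j⁻¹) = wordLength S (j * g) := by
    rw [← wordLength_inv]; group
  have e5 : wordLength S ((g⁻¹ * j⁻¹)⁻¹ * g) = wordLength S (g⁻¹ * (g⁻¹ * j⁻¹)) := by
    rw [← wordLength_inv]; group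
  rw [e1, e2, e4, wordLength_inv, wordLength_inv] at h1
  rw [e3, e4, e5] at h2
  have := hH g hg
  have := hH (j * g) (mul_mem hj hg)
  have := wordLength_mul_le hc j g
  omega

/-- Approximate convexity of the length along `g`, `j * g`, `j * j * g`. The other alternative of
the four-point condition fails because `g` is long. -/
theorem FourPoint.two_mul_wordLength_le (h : (mulCayley S).FourPoint δ)
    (hc : (mulCayley S).Connected) (hH : ∀ g ∈ H, wordLength S (g * g) ≤ wordLength S g + c)
    {j g : G} (hj : j ∈ H) (hg : g ∈ H)
    (hl : 4 * wordLength S j + c + 3 * δ < wordLength S g) :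
    2 * wordLength S (j * g) ≤ wordLength S (j * j * g) + wordLength S g + δ := by
  have h1 := h (j⁻¹) g 1 (j * g)
  simp only [dist_mulCayley] at h1
  have e1 : (j⁻¹)⁻¹ * (j * g) = j * j * g := by group
  have e2 := wordLength_mul_le hc j⁻¹ (j * g)
  rw [inv_mul_cancel_left] at e2
  have := h.wordLength_conj_le hc hH hj hg
  rw [e1] at h1
  simp only [inv_inv, inv_one, one_mul, mul_one, wordLength_inv] at h1 e2
  omega

theorem FourPoint.wordLength_mul_le_add (h : (mulCayley S).FourPoint δ)
    (hc : (mulCayley S).Connected) (hH : ∀ g ∈ H, wordLength S (g * g) ≤ wordLength S g + c)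
    {j : G} (hj : j ∈ H) :
    ∃ M, ∀ g ∈ H, M ≤ wordLength S g → wordLength S (j * g) ≤ wordLength S g + δ := by
  obtain ⟨i, hi⟩ := Nat.exists_add_mul_lt_two_pow (wordLength S j) c
  refine ⟨4 * (wordLength S j + i * c) + c + 3 * δ + 1, fun g hg hM => ?_⟩
  by_contra! hlt
  -- By convexity, squaring `k` doubles its gain over `δ`, while `k` itself lengthens by at most
  -- `c`.
  have key : ∀ n ≤ i, ∃ k ∈ H, wordLength S k ≤ wordLength S j + n * c ∧
      wordLength S g + δ + 2 ^ n ≤ wordLength S (k * g) := by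
    intro n
    induction n with
    | zero => intro _; exact ⟨j, hj, by simp, by simpa using hlt⟩
    | succ n ih =>
      intro hn
      obtain ⟨k, hk, hkl, hkg⟩ := ih (by omega)
      have hni : n * c ≤ i * c := Nat.mul_le_mul_right _ (by omega)
      refine ⟨k * k, mul_mem hk hk, ?_, ?_⟩
      · have := hH k hk
        rw [add_mul]; omega
      · have := h.two_mul_wordLength_le hc hH hk hg (by omega)
        rw [pow_succ]; omega
  obtain ⟨k, hk, hkl, hkg⟩ := key i le_rfl
  have := wordLength_mul_le hc k g
  omega

/-- Left multiplication by `j` changes the length of a far `g` by at most `δ`, and the geodesics to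
`g` and `j * g` fellow-travel beyond radius `r`. Hence `p` and `j * p` are matched without a shift.
-/
theorem FourPoint.wordLength_conj_le_of_far (h : (mulCayley S).FourPoint δ)
    (hc : (mulCayley S).Connected) (hH : ∀ g ∈ H, wordLength S (g * g) ≤ wordLength S g + c)
    {j : G} (hj : j ∈ H) {r : ℕ} (hr : wordLength S j ≤ r) :
    ∃ M, ∀ g ∈ H, M ≤ wordLength S g → ∀ p, wordLength S p = r →
      r + wordLength S (p⁻¹ * g) = wordLength S g → wordLength S (p⁻¹ * (j * p)) ≤ 4 * δ := by
  obtain ⟨M₁, hM₁⟩ := h.wordLength_mul_le_add hc hH hj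
  obtain ⟨M₂, hM₂⟩ := h.wordLength_mul_le_add hc hH (inv_mem hj)
  refine ⟨M₁ + M₂ + 4 * r + c + 2 * δ, fun g hg hM p hp hpg => ?_⟩
  have h1 := hM₁ g hg (by omega)
  have h0 := wordLength_mul_le hc j⁻¹ (j * g)
  rw [inv_mul_cancel_left, wordLength_inv] at h0
  have h2 := hM₂ (j * g) (mul_mem hj hg) (by omega)
  rw [inv_mul_cancel_left] at h2
  have h3 := h.left_one g p (j * g)
  have h4 := h.left_one (j * p) j (j * g)
  have h5 := h p (j * p) 1 (j * g)
  simp only [dist_mulCayley] at h5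
  have h6 := h.wordLength_conj_le hc hH hj hg
  have e1 : (j * p)⁻¹ * (j * g) = p⁻¹ * g := by group
  have e2 : wordLength S ((j * p)⁻¹ * j) = r := by rw [← hp, ← wordLength_inv]; group
  have e3 : wordLength S (g⁻¹ * p) = wordLength S (p⁻¹ * g) := by rw [← wordLength_inv]; group
  rw [e1, e2, inv_mul_cancel_left] at h4
  rw [e1] at h5
  simp only [inv_one, one_mul, mul_one, wordLength_inv] at h5
  omega

/-- A subgroup of a hyperbolic group none of whose elements stretches under squaring is finite. -/
theorem FourPoint.finite_of_wordLength_sq_le (h : (mulCayley S).FourPoint δ) (hS : S.Finite)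
    (hc : (mulCayley S).Connected) (hH : ∀ g ∈ H, wordLength S (g * g) ≤ wordLength S g + c) :
    (H : Set G).Finite := by
  by_contra hinf
  have hball := finite_wordLength_le hS hc (4 * δ)
  obtain ⟨F, hFH, hF⟩ := Set.Infinite.exists_subset_card_eq hinf (hball.toFinset.card + 1)
  obtain ⟨r, hr⟩ : ∃ r, ∀ j ∈ F, wordLength S j ≤ r := ⟨F.sup (wordLength S), fun j hj =>
    Finset.le_sup (f := wordLength S) hj⟩
  have hM : ∀ j, ∃ M, j ∈ F → ∀ g ∈ H, M ≤ wordLength S g → ∀ p, wordLength S p = r →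
      r + wordLength S (p⁻¹ * g) = wordLength S g → wordLength S (p⁻¹ * (j * p)) ≤ 4 * δ := by
    intro j
    by_cases hj : j ∈ F
    · obtain ⟨M, hM⟩ := h.wordLength_conj_le_of_far hc hH (hFH hj) (hr j hj)
      exact ⟨M, fun _ => hM⟩
    · exact ⟨0, fun h => absurd h hj⟩
  choose M hM using hM
  obtain ⟨g, hg, hgl⟩ : ∃ g ∈ H, F.sup M + r < wordLength S g := by
    by_contra! hle
    exact hinf ((finite_wordLength_le hS hc (F.sup M + r)).subset hle)
  obtain ⟨p, hp1, hp2⟩ := hc.exists_between 1 g (i := r) (by change r ≤ wordLength S g; omega)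
  rw [dist_mulCayley] at hp1 hp2
  rw [dist_mulCayley, inv_one, one_mul] at hp2
  rw [inv_one, one_mul] at hp1
  -- Conjugation by the single element `p` injects `F` into a ball with fewer elements than `F`.
  have hcard : F.card ≤ hball.toFinset.card := by
    refine Finset.card_le_card_of_injOn (fun j => p⁻¹ * (j * p)) ?_ ?_
    · intro j hj
      have hle : M j ≤ F.sup M := Finset.le_sup (f := M) hj
      simpa using hM j hj g hg (by omega) p hp1 (by omega)
    · intro a _ b _ hab
      simpa using hab
  omega

end NotLoxodromic

/-! ### Loxodromic elements. -/

/-- The powers of `t` are distinct and form a quasi-geodesic. -/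
structure IsLoxodromic (S : Set G) (B : ℕ) (t : G) : Prop where
  le_wordLength : ∀ n : ℕ, n ≤ wordLength S (t ^ n)
  add_le : ∀ n k : ℕ, wordLength S (t ^ n) + wordLength S (t ^ k) ≤ wordLength S (t ^ (n + k)) + B

/-- A local-to-global argument: the four points `1`, `t`, `t * t`, `t ^ (n + 2)` propagate a gain of
more than `δ` from each power to the next. -/
theorem FourPoint.isLoxodromic (h : (mulCayley S).FourPoint δ) (hc : (mulCayley S).Connected)
    {t : G} (ht : wordLength S t + 2 * δ + 1 ≤ wordLength S (t * t)) :
    IsLoxodromic S (wordLength S t + δ) t := by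
  have hstep : ∀ n, wordLength S (t ^ n) + δ + 1 ≤ wordLength S (t ^ (n + 1)) := by
    intro n
    induction n with
    | zero =>
      have := wordLength_mul_le hc t t
      simp; omega
    | succ n ih =>
      have h1 := h.left_one (t * t) t (t ^ (n + 2))
      have e1 : t⁻¹ * t ^ (n + 2) = t ^ (n + 1) := by rw [pow_succ' t (n + 1)]; group
      have e2 : (t * t)⁻¹ * t ^ (n + 2) = t ^ n := by
        rw [pow_succ' t (n + 1), pow_succ' t n]; group
      have e3 : (t * t)⁻¹ * t = t⁻¹ := by group
      rw [e1, e2, e3, wordLength_inv] at h1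
      change _ ≤ wordLength S (t ^ (n + 2))
      omega
  refine ⟨fun n => ?_, fun n k => ?_⟩
  · induction n with
    | zero => simp
    | succ n ih => have := hstep n; omega
  · rcases k with _ | k
    · simp
    have h1 := h.left_one (t ^ (k + 1))⁻¹ (t ^ n) t⁻¹
    have e1 : wordLength S ((t ^ n)⁻¹ * t⁻¹) = wordLength S (t ^ (n + 1)) := by
      rw [← wordLength_inv, pow_succ']; group
    have e2 : ((t ^ (k + 1))⁻¹)⁻¹ * t⁻¹ = t ^ k := by rw [pow_succ]; group
    have e3 : ((t ^ (k + 1))⁻¹)⁻¹ * t ^ n = t ^ (n + (k + 1)) := by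
      rw [inv_inv, ← pow_add, add_comm]
    rw [e1, e2, e3, wordLength_inv, wordLength_inv] at h1
    have := hstep n; have := hstep k
    omega

namespace IsLoxodromic

variable {B : ℕ} {t : G}

theorem inv (ht : IsLoxodromic S B t) : IsLoxodromic S B t⁻¹ := by
  refine ⟨fun n => ?_, fun n k => ?_⟩
  · simpa using ht.le_wordLength n
  · simpa using ht.add_le n k

theorem pow (ht : IsLoxodromic S B t) {m : ℕ} (hm : 0 < m) : IsLoxodromic S B (t ^ m) := by
  refine ⟨fun n => ?_, fun n k => ?_⟩
  · rw [← pow_mul]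
    exact (Nat.le_mul_of_pos_left n hm).trans (ht.le_wordLength _)
  · simpa only [← pow_mul, mul_add] using ht.add_le (m * n) (m * k)

/-- If the identity is a nearest point to `z` among the powers of `t`, then the Gromov product of
`z` with any power of `t` is bounded. -/
theorem nearest (ht : IsLoxodromic S B t) (h : (mulCayley S).FourPoint δ)
    (hc : (mulCayley S).Connected) {z : G}
    (hz : ∀ k : ℕ, wordLength S z ≤ wordLength S (z⁻¹ * t ^ k)) (n : ℕ) :
    wordLength S z + wordLength S (t ^ n) ≤
      wordLength S (z⁻¹ * t ^ n) + (2 * wordLength S t + 2 * B + 2 * δ) := by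
  classical
  -- The least such `k` marks where the geodesic to `z` branches off the powers of `t`. As `1` is
  -- nearest to `z`, this must happen close to `1`.
  have hex : ∃ k, wordLength S z + wordLength S (t ^ n) ≤
      wordLength S (z⁻¹ * t ^ n) + 2 * wordLength S (t ^ k) := ⟨n, by have := hz n; omega⟩
  have hfind := Nat.find_spec hex
  have hle : Nat.find hex ≤ n := Nat.find_min' hex (by have := hz n; omega)
  rcases hk : Nat.find hex with _ | k
  · rw [hk] at hfind
    simp at hfind; omega
  · have hlt := Nat.find_min hex (m := k) (by omega)
    rw [hk] at hfind hle
    have h1 := h.left_one (t ^ n) z (t ^ (k + 1))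
    have e1 : wordLength S ((t ^ n)⁻¹ * t ^ (k + 1)) = wordLength S (t ^ (n - (k + 1))) := by
      rw [← wordLength_inv, mul_inv_rev, inv_inv]
      congr 1
      rw [inv_mul_eq_iff_eq_mul, ← pow_add]
      congr 1; omega
    have e2 : wordLength S ((t ^ n)⁻¹ * z) = wordLength S (z⁻¹ * t ^ n) := by
      rw [← wordLength_inv]; group
    have h2 := ht.add_le (k + 1) (n - (k + 1))
    rw [show k + 1 + (n - (k + 1)) = n by omega] at h2
    have h3 := hz (k + 1)
    have h4 := wordLength_mul_le hc (S := S) t (t ^ k)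
    rw [← pow_succ'] at h4
    rw [e1, e2] at h1
    omega

end IsLoxodromic

end SimpleGraph

open scoped Pointwise

/-! ### Coarse translations of a commensurated subgroup. -/

section CoarseTranslation

open SimpleGraph

variable {G : Type*} [Group G] {H : Subgroup G} {T : Set H}

theorem Subgroup.IsCommensurated.exists_finite (hcomm : H.IsCommensurated) (u : G) :
    ∃ E : Set G, E.Finite ∧ ∀ h : H, ∃ e ∈ E, u * h * e ∈ H := by
  set K := H.map (MulAut.conj u).toMonoidHom with hK
  have : (H.subgroupOf K).FiniteIndex := ⟨(hcomm u).2⟩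
  refine ⟨Set.range fun q : K ⧸ H.subgroupOf K => u⁻¹ * q.out, Set.finite_range _, ?_⟩
  intro h
  have hk : u * h * u⁻¹ ∈ K := ⟨h, h.2, by simp⟩
  let k : K := ⟨_, hk⟩
  refine ⟨_, ⟨((k⁻¹ : K) : K ⧸ H.subgroupOf K), rfl⟩, ?_⟩
  have h1 := (QuotientGroup.out_eq' ((k⁻¹ : K) : K ⧸ H.subgroupOf K)).symm
  rw [QuotientGroup.eq, Subgroup.mem_subgroupOf, inv_inv, Subgroup.coe_mul] at h1
  simpa only [k, mul_assoc] using h1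

/-- `f h` lies in `u h E` for every `h` in `H`. -/
def IsCoarseTranslation (u : G) (E : Set G) (f : H → H) : Prop :=
  ∀ h, ∃ e ∈ E, (f h : G) = u * h * e

theorem Subgroup.IsCommensurated.exists_isCoarseTranslation (hcomm : H.IsCommensurated) (u : G) :
    ∃ E : Set G, E.Finite ∧ ∃ f : H → H, IsCoarseTranslation u E f := by
  obtain ⟨E, hE, hEH⟩ := hcomm.exists_finite u
  choose e he heH using hEH
  exact ⟨E, hE, fun h => ⟨_, heH h⟩, fun h => ⟨_, he h, rfl⟩⟩

/-- The factors `h₁` and `h₂` are absorbed by exact translations of `H`, so the error set depends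
only on `S`. This is the source of uniformity for adjacent cosets. -/
theorem Subgroup.IsCommensurated.exists_isCoarseTranslation_doubleCoset
    (hcomm : H.IsCommensurated) {S : Set G} (hS : S.Finite) :
    ∃ E : Set G, E.Finite ∧ ∀ s ∈ S, ∀ h₁ h₂ : H,
      ∃ f : H → H, IsCoarseTranslation ((h₁ : G) * s * h₂) E f := by
  choose E hE f hf using fun u => hcomm.exists_isCoarseTranslation u
  refine ⟨⋃ s ∈ S, E s, hS.biUnion fun s _ => hE s, fun s hs h₁ h₂ => ?_⟩
  refine ⟨fun h => h₁ * f s (h₂ * h), fun h => ?_⟩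
  obtain ⟨e, he, heq⟩ := hf s (h₂ * h)
  refine ⟨e, Set.mem_biUnion hs he, ?_⟩
  simp [heq, mul_assoc]

theorem exists_wordLength_le (T : Set H) {A : Set G} (hA : A.Finite) :
    ∃ L, ∀ h : H, (h : G) ∈ A → wordLength T h ≤ L := by
  have hfin : ((fun h : H => (h : G)) ⁻¹' A).Finite :=
    hA.preimage (Subtype.val_injective.injOn)
  obtain ⟨L, hL⟩ := (hfin.image (wordLength T)).bddAbove
  exact ⟨L, fun h hh => hL ⟨h, hh, rfl⟩⟩

theorem finite_coe_wordLength_le (hT : T.Finite) (hc : (mulCayley T).Connected) (n : ℕ) :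
    ((fun h : H => (h : G)) '' {h | wordLength T h ≤ n}).Finite :=
  (finite_wordLength_le hT hc n).image _

namespace IsCoarseTranslation

theorem id : IsCoarseTranslation (1 : G) {1} (fun h : H => h) := fun h => ⟨1, rfl, by simp⟩

theorem comp {u u' : G} {E E' : Set G} {f f' : H → H} (hf' : IsCoarseTranslation u' E' f')
    (hf : IsCoarseTranslation u E f) :
    IsCoarseTranslation (u' * u) (E * E') (fun h => f' (f h)) := by
  intro h
  obtain ⟨e, he, heq⟩ := hf h
  obtain ⟨e', he', heq'⟩ := hf' (f h)
  exact ⟨e * e', Set.mul_mem_mul he he', by rw [heq', heq]; group⟩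

theorem exists_dist_le (T : Set H) {E E' : Set G} (hE : E.Finite) (hE' : E'.Finite) :
    ∃ K, ∀ (u : G) (f f' : H → H), IsCoarseTranslation u E f → IsCoarseTranslation u E' f' →
      ∀ h, (mulCayley T).dist (f h) (f' h) ≤ K := by
  obtain ⟨L, hL⟩ := exists_wordLength_le T (hE.inv.mul hE')
  refine ⟨L, fun u f f' hf hf' h => ?_⟩
  obtain ⟨e, he, heq⟩ := hf h
  obtain ⟨e', he', heq'⟩ := hf' h
  rw [dist_mulCayley]
  refine hL _ ⟨e⁻¹, Set.inv_mem_inv.2 he, e', he', ?_⟩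
  simp only [Subgroup.coe_mul, Subgroup.coe_inv, heq, heq']
  group

theorem exists_lipschitzOnEdges (hT : T.Finite) (hc : (mulCayley T).Connected) {E : Set G}
    (hE : E.Finite) : ∃ L, ∀ (u : G) (f : H → H), IsCoarseTranslation u E f →
      LipschitzOnEdges (mulCayley T) (mulCayley T) L f := by
  obtain ⟨L, hL⟩ := exists_wordLength_le T
    ((hE.inv.mul (finite_coe_wordLength_le hT hc 1)).mul hE)
  refine ⟨L, fun u f hf x y hxy => ?_⟩
  obtain ⟨e, he, heq⟩ := hf x
  obtain ⟨e', he', heq'⟩ := hf y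
  rw [dist_mulCayley] at hxy ⊢
  refine hL _ ⟨_, ⟨e⁻¹, Set.inv_mem_inv.2 he, _, ⟨_, hxy, rfl⟩, rfl⟩, e', he', ?_⟩
  simp only [Subgroup.coe_mul, Subgroup.coe_inv, heq, heq']
  group

theorem exists_wordLength_le_of_dist_le (hT : T.Finite) (hc : (mulCayley T).Connected)
    {E : Set G} (hE : E.Finite) {u : G} {f : H → H} (hf : IsCoarseTranslation u E f) (c : H)
    (R : ℕ) : ∃ N, ∀ h, (mulCayley T).dist c (f h) ≤ R → wordLength T h ≤ N := by
  obtain ⟨N, hN⟩ := exists_wordLength_le T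
    (((Set.finite_singleton (u⁻¹ * c)).mul (finite_coe_wordLength_le hT hc R)).mul hE.inv)
  refine ⟨N, fun h hh => ?_⟩
  obtain ⟨e, he, heq⟩ := hf h
  rw [dist_mulCayley] at hh
  refine hN _ ⟨_, ⟨_, rfl, _, ⟨_, hh, rfl⟩, rfl⟩, e⁻¹, Set.inv_mem_inv.2 he, ?_⟩
  simp only [Subgroup.coe_mul, Subgroup.coe_inv, heq]
  group

/-- Coarse translations by `u` and `u⁻¹` are quasi-inverse, with constants depending on the error
sets but not on `u`; quasi-isometries preserve approximate betweenness. -/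
theorem exists_isCenter {δ : ℕ} (h4 : (mulCayley T).FourPoint δ) (hT : T.Finite)
    (hc : (mulCayley T).Connected) {E E' : Set G} (hE : E.Finite) (hE' : E'.Finite) (κ : ℕ) :
    ∃ κ', ∀ (u : G) (f f' : H → H), IsCoarseTranslation u E f → IsCoarseTranslation u⁻¹ E' f' →
      ∀ m x y z, (mulCayley T).IsCenter κ m x y z →
        (mulCayley T).IsCenter κ' (f m) (f x) (f y) (f z) := by
  obtain ⟨L₁, hL₁⟩ := exists_lipschitzOnEdges hT hc hE
  obtain ⟨L₂, hL₂⟩ := exists_lipschitzOnEdges hT hc hE'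
  obtain ⟨K₁, hK₁⟩ := exists_dist_le T (hE'.mul hE) (Set.finite_singleton 1)
  obtain ⟨K₂, hK₂⟩ := exists_dist_le T (hE.mul hE') (Set.finite_singleton 1)
  obtain ⟨κ', hκ'⟩ := exists_between_constant δ (L₁ + L₂ + K₁) (κ + 4 * K₂)
  refine ⟨κ', fun u f f' hf hf' m x y z hm => ?_⟩
  have h1 : ∀ y, (mulCayley T).dist (f (f' y)) y ≤ K₁ := fun y =>
    hK₁ 1 _ _ (by simpa using hf.comp hf') id y
  have h2 : ∀ y, (mulCayley T).dist (f' (f y)) y ≤ K₂ := fun y =>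
    hK₂ 1 _ _ (by simpa using hf'.comp hf) id y
  have hlf : LipschitzOnEdges (mulCayley T) (mulCayley T) (L₁ + L₂ + K₁) f := fun x y hxy => by
    have := hL₁ u f hf x y hxy; omega
  have hlf' : LipschitzOnEdges (mulCayley T) (mulCayley T) (L₁ + L₂ + K₁) f' := fun x y hxy => by
    have := hL₂ _ f' hf' x y hxy; omega
  have key : ∀ x y, (mulCayley T).dist x m + (mulCayley T).dist m y ≤
      (mulCayley T).dist x y + κ → (mulCayley T).dist (f x) (f m) + (mulCayley T).dist (f m) (f y) ≤
      (mulCayley T).dist (f x) (f y) + κ' := by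
    intro x y hxy
    refine hκ' h4 hc hc hlf hlf' (fun y => by have := h1 y; omega) _ _ _ ?_
    have tri := fun a b c => hc.dist_triangle (u := a) (v := b) (w := c)
    have := h2 x; have := h2 y
    have := tri (f' (f x)) x m; have := tri m y (f' (f y))
    have := tri x (f' (f x)) (f' (f y)); have := tri x (f' (f y)) y
    have := (mulCayley T).dist_comm (u := x) (v := f' (f x))
    have := (mulCayley T).dist_comm (u := y) (v := f' (f y))
    omega
  exact ⟨key _ _ hm.1, key _ _ hm.2.1, key _ _ hm.2.2⟩

end IsCoarseTranslation

theorem SimpleGraph.IsCenter.mono {V : Type*} {Γ : SimpleGraph V} {κ κ' : ℕ} {m x y z : V}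
    (h : Γ.IsCenter κ m x y z) (hκ : κ ≤ κ') : Γ.IsCenter κ' m x y z := by
  obtain ⟨h1, h2, h3⟩ := h
  exact ⟨by omega, by omega, by omega⟩

/-! ### Bounded sections from large tripods. -/

/-- A section of `G → G ⧸ H` moving neighbours in the Cayley–Abels graph by a bounded amount. -/
def HasBoundedSection (H : Subgroup G) (S : Set G) : Prop :=
  ∃ σ : G ⧸ H → G, (∀ a, (σ a : G ⧸ H) = a) ∧ ∃ F : Set G, F.Finite ∧
    ∀ a b, (cayleyAbelsGraph H S).Adj a b → (σ a)⁻¹ * σ b ∈ F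

theorem exists_doubleCoset_of_adj {S : Set G} {a b : G ⧸ H} (hab : (cayleyAbelsGraph H S).Adj a b)
    {g k : G} (hg : (g : G ⧸ H) = a) (hk : (k : G ⧸ H) = b) :
    ∃ s ∈ S ∪ S⁻¹, ∃ h₁ h₂ : H, g⁻¹ * k = (h₁ : G) * s * h₂ := by
  subst hg hk
  rw [cayleyAbelsGraph, fromRel_adj] at hab
  rcases hab.2 with ⟨x, s, hs, h1, h2⟩ | ⟨x, s, hs, h1, h2⟩
  · rw [QuotientGroup.eq] at h1 h2
    refine ⟨s, Or.inl hs, ⟨_, h1⟩, ⟨_, inv_mem h2⟩, ?_⟩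
    simp only; group
  · rw [QuotientGroup.eq] at h1 h2
    refine ⟨s⁻¹, Or.inr (Set.inv_mem_inv.2 hs), ⟨_, h2⟩, ⟨_, inv_mem h1⟩, ?_⟩
    simp only; group

/-- If `H` contains arbitrarily large tripods, barycenters of transported tripods give a bounded
section. -/
theorem hasBoundedSection_of_tripods {δ C : ℕ} (hcomm : H.IsCommensurated) {S : Set G}
    (hS : S.Finite) (h4 : (mulCayley T).FourPoint δ) (hT : T.Finite)
    (hc : (mulCayley T).Connected)
    (htri : ∀ R, ∃ x y z : H, R ≤ wordLength T x ∧ R ≤ wordLength T y ∧ R ≤ wordLength T z ∧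
      (mulCayley T).IsCenter C 1 x y z) : HasBoundedSection H S := by
  choose x y z hx hy hz hcen using htri
  choose Eφ hEφ φ hφ using fun a : G ⧸ H => hcomm.exists_isCoarseTranslation (a.out)⁻¹
  choose Eψ hEψ ψ hψ using fun a : G ⧸ H => hcomm.exists_isCoarseTranslation a.out
  choose m hm using fun (a : G ⧸ H) (n : ℕ) =>
    h4.exists_isCenter hc (φ a (x n)) (φ a (y n)) (φ a (z n))
  -- All `m a n` lie in a finite ball around `φ a 1`, because `1` is a center of every tripod. Using
  -- one ultrafilter for all cosets lets two limits be attained at a common large `n`.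
  have hlim : ∀ a, ∃ m', ∀ᶠ n in (Filter.hyperfilter ℕ : Filter ℕ), m a n = m' := by
    intro a
    obtain ⟨κ, hκ⟩ := IsCoarseTranslation.exists_isCenter h4 hT hc (hEφ a) (hEψ a) C
    have hfin : {g : H | (mulCayley T).dist (φ a 1) g ≤ 2 * (κ + (δ + 2)) + δ}.Finite := by
      simp only [dist_mulCayley]
      exact (finite_wordLength_le hT hc _).preimage (mul_right_injective _).injOn
    have hmem : ∀ᶠ n in (Filter.hyperfilter ℕ : Filter ℕ),
        ∃ g ∈ {g : H | (mulCayley T).dist (φ a 1) g ≤ 2 * (κ + (δ + 2)) + δ}, m a n = g := by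
      refine Filter.Eventually.of_forall fun n => ⟨m a n, ?_, rfl⟩
      refine h4.dist_centers_le ((hκ _ _ _ (hφ a) (by simpa using hψ a) _ _ _ _ (hcen n)).mono ?_)
        ((hm a n).mono ?_) <;> omega
    obtain ⟨g, -, hg⟩ := (Ultrafilter.eventually_exists_mem_iff hfin).1 hmem
    exact ⟨g, hg⟩
  choose μ hμ using hlim
  obtain ⟨E, hE, hES⟩ := hcomm.exists_isCoarseTranslation_doubleCoset (hS.union hS.inv)
  obtain ⟨κ, hκ⟩ := IsCoarseTranslation.exists_isCenter h4 hT hc hE hE (δ + 2)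
  refine ⟨fun a => a.out * μ a, fun a => ?_, E * ((fun h : H => (h : G)) ''
    {h | wordLength T h ≤ 2 * (κ + 2 * δ + (δ + 2)) + δ}),
    hE.mul (finite_coe_wordLength_le hT hc _), fun a b hab => ?_⟩
  · rw [QuotientGroup.mk_mul_of_mem _ (μ a).2]; simp
  have hdc : ∀ {a b : G ⧸ H}, (cayleyAbelsGraph H S).Adj a b →
      ∃ f : H → H, IsCoarseTranslation (a.out⁻¹ * b.out) E f := by
    intro a b hab
    obtain ⟨s, hs, h₁, h₂, heq⟩ := exists_doubleCoset_of_adj hab (g := a.out) (k := b.out)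
      (by simp) (by simp)
    rw [heq]
    exact hES s hs h₁ h₂
  obtain ⟨f, hf⟩ := hdc hab.symm
  obtain ⟨f', hf'⟩ := hdc hab
  have hfφ : IsCoarseTranslation (b.out)⁻¹ (Eφ a * E) (fun h => f (φ a h)) := by
    simpa using hf.comp (hφ a)
  -- `K` depends on `a` and `b`, but it only governs how far the corners must be; the final bound
  -- does not involve it.
  obtain ⟨K, hK⟩ := IsCoarseTranslation.exists_dist_le T ((hEφ a).mul hE) (hEφ b)
  have hK := hK _ _ _ hfφ (hφ b)
  obtain ⟨N, hN⟩ := hfφ.exists_wordLength_le_of_dist_le hT hc ((hEφ a).mul hE) (f (μ a))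
    (2 * K + κ + 2 * δ)
  have hfar : ∀ g : H, N + 1 ≤ wordLength T g →
      2 * K + κ + 2 * δ < (mulCayley T).dist (f (μ a)) (f (φ a g)) := by
    intro g hg
    by_contra! hle
    have := hN g hle
    omega
  have hev : ∀ᶠ n in (Filter.hyperfilter ℕ : Filter ℕ), N + 1 ≤ n :=
    Nat.hyperfilter_le_atTop (Filter.eventually_ge_atTop (N + 1))
  obtain ⟨n, hna, hnb, hn⟩ := ((hμ a).and ((hμ b).and hev)).exists
  have hca := hm a n
  have hcb := hm b n
  rw [hna] at hca
  rw [hnb] at hcb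
  have h1 := hκ _ f f' hf (by simpa using hf') _ _ _ _ hca
  have h2 := h4.isCenter_of_dist_le hc h1 (hK (x n)) (hK (y n)) (hK (z n))
    (hfar _ (hn.trans (hx n))) (hfar _ (hn.trans (hy n))) (hfar _ (hn.trans (hz n)))
  have h3 := h4.dist_centers_le (h2.mono (κ' := κ + 2 * δ + (δ + 2)) (by omega))
    (hcb.mono (by omega))
  rw [dist_mulCayley] at h3
  obtain ⟨e, he, heq⟩ := hf (μ a)
  refine ⟨e, he, _, ⟨_, h3, rfl⟩, ?_⟩
  simp only [Subgroup.coe_mul, Subgroup.coe_inv, heq]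
  group

end CoarseTranslation

open SimpleGraph

/-! ### Subgroups without large tripods. -/

section NoTripods

variable {G : Type*} [Group G] {S : Set G} {δ B : ℕ} {t : G}

theorem exists_nearest_zpow (S : Set G) (t g : G) : ∃ m : ℤ, ∀ k : ℤ,
    wordLength S (t ^ m * g) ≤ wordLength S ((t ^ m * g)⁻¹ * t ^ k) := by
  obtain ⟨m, -, hm⟩ := WellFounded.has_min
    (measure fun m : ℤ => wordLength S (t ^ m * g)).wf Set.univ ⟨0, trivial⟩
  refine ⟨m, fun k => ?_⟩
  have h := hm (m - k) trivial
  have e : wordLength S ((t ^ m * g)⁻¹ * t ^ k) = wordLength S (t ^ (m - k) * g) := by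
    rw [← wordLength_inv, sub_eq_neg_add, zpow_add]; group
  rw [e]
  exact not_lt.1 h

theorem SimpleGraph.IsLoxodromic.nearest_zpow (ht : IsLoxodromic S B t)
    (h : (mulCayley S).FourPoint δ) (hc : (mulCayley S).Connected) {z : G}
    (hz : ∀ k : ℤ, wordLength S z ≤ wordLength S (z⁻¹ * t ^ k)) (n : ℤ) :
    wordLength S z + wordLength S (t ^ n) ≤
      wordLength S (z⁻¹ * t ^ n) + (2 * wordLength S t + 2 * B + 2 * δ) := by
  obtain ⟨k, rfl | rfl⟩ := n.eq_nat_or_neg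
  · simpa using ht.nearest h hc (fun k => by simpa using hz k) k
  · simpa using ht.inv.nearest h hc (fun k => by simpa using hz (-k)) k

/-- In a group without large tripods, the powers of a loxodromic element are coarsely dense. -/
theorem SimpleGraph.IsLoxodromic.exists_zpow_near (ht : IsLoxodromic S B t)
    (h : (mulCayley S).FourPoint δ) (hc : (mulCayley S).Connected)
    (hno : ∀ C, ∃ R, ∀ x y z : G, R ≤ wordLength S x → R ≤ wordLength S y →
      R ≤ wordLength S z → ¬ (mulCayley S).IsCenter C 1 x y z) :
    ∃ R, ∀ g, ∃ m : ℤ, wordLength S (t ^ m * g) ≤ R := by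
  obtain ⟨R, hR⟩ := hno (2 * wordLength S t + 2 * B + 2 * δ)
  refine ⟨R, fun g => ?_⟩
  obtain ⟨m, hm⟩ := exists_nearest_zpow S t g
  refine ⟨m, ?_⟩
  by_contra! hlt
  have hl := ht.le_wordLength R
  -- If `t ^ m * g` were long, it would span with `t ^ R` and its inverse a large tripod centered at
  -- `1`.
  refine hR (t ^ R) (t ^ R)⁻¹ (t ^ m * g) hl (by simpa using hl) hlt.le ⟨?_, ?_, ?_⟩
  · have h1 := ht.add_le R R
    have e : wordLength S ((t ^ R)⁻¹ * (t ^ R)⁻¹) = wordLength S (t ^ (R + R)) := by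
      rw [← wordLength_inv, pow_add]; group
    simp only [dist_mulCayley, mul_one, inv_one, one_mul, wordLength_inv, e]
    omega
  · have h1 := ht.nearest_zpow h hc hm (-R)
    have e : wordLength S ((t ^ m * g)⁻¹ * t ^ (-(R : ℤ))) =
        wordLength S (t ^ R * (t ^ m * g)) := by
      rw [← wordLength_inv, ← zpow_natCast]; group
    rw [e, zpow_neg, zpow_natCast, wordLength_inv] at h1
    simp only [dist_mulCayley, mul_one, inv_one, one_mul, inv_inv]
    omega
  · have h1 := ht.nearest_zpow h hc hm R
    have e : wordLength S ((t ^ m * g)⁻¹ * t ^ (R : ℤ)) =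
        wordLength S ((t ^ R)⁻¹ * (t ^ m * g)) := by
      rw [← wordLength_inv, ← zpow_natCast]; group
    rw [e, zpow_natCast] at h1
    simp only [dist_mulCayley, mul_one, inv_one, one_mul, wordLength_inv]
    omega

/-- An element conjugating a power of a loxodromic element `t` to a power of `t` is close to the
powers of `t`. -/
theorem SimpleGraph.IsLoxodromic.wordLength_le_of_conj (ht : IsLoxodromic S B t)
    (h : (mulCayley S).FourPoint δ) (hc : (mulCayley S).Connected) {z : G}
    (hz : ∀ k : ℤ, wordLength S z ≤ wordLength S (z⁻¹ * t ^ k)) {p : ℕ} (hp : 0 < p) {q : ℤ}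
    (hpq : z * t ^ p * z⁻¹ = t ^ q) :
    wordLength S z ≤ 2 * wordLength S t + 3 * B + 5 * δ := by
  obtain ⟨n, hn⟩ : ∃ n, n = 4 * wordLength S z + 2 * wordLength S t + 3 * B + 5 * δ := ⟨_, rfl⟩
  obtain ⟨A, hA⟩ : ∃ A, A = wordLength S (t ^ (p * n)) := ⟨_, rfl⟩
  have hAn : n ≤ A := hA ▸ (Nat.le_mul_of_pos_left n hp).trans (ht.le_wordLength _)
  have hconj : ∀ k : ℤ, t ^ (q * k) = z * (t ^ p) ^ k * z⁻¹ := by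
    intro k
    rw [zpow_mul, ← hpq, conj_zpow]
  have hlen : ∀ k : ℤ, (k = n ∨ k = -n) → wordLength S ((t ^ p) ^ k) = A := by
    rintro k (rfl | rfl) <;> simp [hA, pow_mul]
  -- a geodesic from `z` to `z * t ^ (p * k)` passes near `1`
  have hside : ∀ k : ℤ, (k = n ∨ k = -n) →
      wordLength S z + wordLength S (z * (t ^ p) ^ k) ≤
        A + (2 * wordLength S t + 2 * B + 3 * δ) := by
    intro k hk
    have h1 := ht.nearest_zpow h hc hz (q * k)
    have h2 := h z (t ^ (q * k)) (z * (t ^ p) ^ k) 1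
    have h3 := hc.dist_triangle (u := z) (v := t ^ (q * k)) (w := z * (t ^ p) ^ k)
    have e1 : (z * (t ^ p) ^ k)⁻¹ * t ^ (q * k) = z⁻¹ := by rw [hconj]; group
    have e2 := (mulCayley S).dist_comm (u := t ^ (q * k)) (v := z * (t ^ p) ^ k)
    rw [e2] at h2 h3
    simp only [dist_mulCayley, e1, mul_one, wordLength_inv, inv_mul_cancel_left, hlen k hk]
      at h2 h3
    omega
  have h1 := hside n (Or.inl rfl)
  have h2 := hside (-n) (Or.inr rfl)
  -- The two halves of the line `z * ⟨t ^ p⟩` leaving `z` both pass near `1`. They diverge at `z`,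
  -- so `z` cannot be far from `1`.
  have h3 := h z 1 (z * (t ^ p) ^ (n : ℤ)) (z * (t ^ p) ^ (-n : ℤ))
  have h4 := ht.add_le (p * n) (p * n)
  have e : wordLength S ((z * (t ^ p) ^ (n : ℤ))⁻¹ * (z * (t ^ p) ^ (-n : ℤ))) =
      wordLength S (t ^ (p * n + p * n)) := by
    rw [← wordLength_inv, pow_add, pow_mul, ← zpow_natCast (t ^ p) n]; group
  simp only [dist_mulCayley, e, mul_one, inv_one, one_mul, wordLength_inv, inv_mul_cancel_left,
    hlen _ (Or.inl rfl), hlen _ (Or.inr rfl)] at h3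
  rw [← hA] at h4
  omega

variable {H : Subgroup G} {T : Set H} {δ' : ℕ}

theorem exists_wordLength_coe_le (hc : (mulCayley S).Connected) (hT : T.Finite)
    (hcT : (mulCayley T).Connected) : ∃ L, ∀ h : H, wordLength S (h : G) ≤ L * wordLength T h := by
  obtain ⟨L, hL⟩ := ((finite_wordLength_le hT hcT 1).image
    fun h : H => wordLength S (h : G)).bddAbove
  refine ⟨L, fun h => ?_⟩
  have hlip : LipschitzOnEdges (mulCayley T) (mulCayley S) L (fun h : H => (h : G)) := by
    intro x y hxy
    rw [dist_mulCayley] at hxy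
    have := hL ⟨_, hxy, rfl⟩
    rw [dist_mulCayley]
    simpa using this
  exact hlip.dist_le hcT hc 1 h

/-- An infinite subgroup of a hyperbolic group contains an element that is loxodromic for both. -/
theorem exists_isLoxodromic (h4 : (mulCayley S).FourPoint δ) (hS : S.Finite)
    (hc : (mulCayley S).Connected) (h4' : (mulCayley T).FourPoint δ') (hT : T.Finite)
    (hcT : (mulCayley T).Connected) (hH : Infinite H) :
    ∃ (t : H) (B B' : ℕ), IsLoxodromic S B (t : G) ∧ IsLoxodromic T B' t := by
  obtain ⟨t, htH, ht⟩ : ∃ t ∈ H, wordLength S t + 2 * δ + 1 ≤ wordLength S (t * t) := by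
    by_contra! hle
    have := h4.finite_of_wordLength_sq_le (c := 2 * δ) hS hc (fun g hg => by
      have := hle g hg; omega)
    exact (Set.infinite_coe_iff.1 hH) this
  have hlox := h4.isLoxodromic hc ht
  obtain ⟨L, hL⟩ := exists_wordLength_coe_le hc hT hcT
  let τ : H := ⟨t, htH⟩
  -- `H` may be distorted in `G`, so stretching must be found again for `T`. Otherwise the
  -- `T`-length of `τ ^ 2 ^ i` would be linear in `i`, although its `S`-length is at least `2 ^ i`
  -- and the inclusion is Lipschitz.
  obtain ⟨i, hi⟩ : ∃ i, wordLength T (τ ^ 2 ^ i) + 2 * δ' + 1 ≤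
      wordLength T (τ ^ 2 ^ i * τ ^ 2 ^ i) := by
    by_contra! hle
    have hlog : ∀ i, wordLength T (τ ^ 2 ^ i) ≤ wordLength T τ + i * (2 * δ') := by
      intro i
      induction i with
      | zero => simp
      | succ i ih =>
        have := hle i
        rw [← pow_add, ← two_mul, ← pow_succ'] at this
        rw [add_mul]; omega
    obtain ⟨i, hi⟩ := Nat.exists_add_mul_lt_two_pow (L * wordLength T τ) (L * (2 * δ'))
    have h1 := hlox.le_wordLength (2 ^ i)
    have h2 := hL (τ ^ 2 ^ i)
    have h3 := Nat.mul_le_mul_left L (hlog i)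
    simp only [Subgroup.coe_pow, τ] at h2 h3
    nlinarith
  exact ⟨τ ^ 2 ^ i, _, _, by simpa [τ] using hlox.pow (Nat.two_pow_pos i), h4'.isLoxodromic hcT hi⟩

/-- An infinite commensurated hyperbolic subgroup without large tripods has finite index. -/
theorem finite_quotient_of_no_tripods (hcomm : H.IsCommensurated)
    (h4 : (mulCayley S).FourPoint δ) (hS : S.Finite)
    (hc : (mulCayley S).Connected) (h4' : (mulCayley T).FourPoint δ') (hT : T.Finite)
    (hcT : (mulCayley T).Connected) (hH : Infinite H)
    (hno : ∀ C, ∃ R, ∀ x y z : H, R ≤ wordLength T x → R ≤ wordLength T y →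
      R ≤ wordLength T z → ¬ (mulCayley T).IsCenter C 1 x y z) : Finite (G ⧸ H) := by
  obtain ⟨t, B, B', ht, ht'⟩ := exists_isLoxodromic h4 hS hc h4' hT hcT hH
  obtain ⟨R, hR⟩ := ht'.exists_zpow_near h4' hcT hno
  have hconj : ∀ g : G, ∃ p : ℕ, 0 < p ∧ ∃ q : ℤ, g * (t : G) ^ p * g⁻¹ = (t : G) ^ q := by
    intro g
    obtain ⟨E, hE, hEH⟩ := hcomm.exists_finite g
    -- Each `g * t ^ i * e i` lies in `H`, and a power of `t` brings it into a finite ball. The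
    -- pigeonhole principle gives two exponents with equal data, and cancelling yields the
    -- conjugation relation.
    choose e he heH using fun i : ℕ => hEH (t ^ i)
    choose m hm using fun i : ℕ => hR ⟨_, heH i⟩
    obtain ⟨i, j, hij, heq⟩ := Set.Finite.exists_lt_map_eq_of_forall_mem
      (f := fun i => (e i, t ^ m i * ⟨_, heH i⟩)) (fun i => Set.mk_mem_prod (he i) (hm i))
      (hE.prod (finite_wordLength_le hT hcT R))
    rw [Prod.mk.injEq, Subtype.ext_iff] at heq
    simp only [Subgroup.coe_mul, Subgroup.coe_pow, Subgroup.coe_zpow] at heq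
    obtain ⟨he', h2⟩ := heq
    refine ⟨j - i, by omega, m i - m j, ?_⟩
    rw [he'] at h2
    have h3 : g * (t : G) ^ j = (t : G) ^ (m i - m j) * (g * (t : G) ^ i) := by
      rw [sub_eq_neg_add, zpow_add, zpow_neg, mul_assoc, eq_inv_mul_iff_mul_eq]
      simp only [← mul_assoc] at h2
      simpa only [mul_assoc] using (mul_right_cancel h2).symm
    have h4 : (t : G) ^ j = (t : G) ^ (j - i) * (t : G) ^ i := by
      rw [← pow_add]; congr 1; omega
    rw [h4, ← mul_assoc, ← mul_assoc] at h3
    rw [mul_right_cancel h3]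
    group
  have hball := (finite_wordLength_le hS hc
    (2 * wordLength S (t : G) + 3 * B + 5 * δ)).image (fun z => ((z⁻¹ : G) : G ⧸ H))
  refine Set.finite_univ_iff.1 (hball.subset fun a _ => ?_)
  obtain ⟨g, rfl⟩ := QuotientGroup.mk_surjective a
  -- The inverse is needed for left cosets: the inverse of `t ^ m * g⁻¹` still represents the coset
  -- of `g`.
  obtain ⟨m, hm⟩ := exists_nearest_zpow S (t : G) g⁻¹
  obtain ⟨p, hp, q, hpq⟩ := hconj ((t : G) ^ m * g⁻¹)
  refine ⟨_, ht.wordLength_le_of_conj h4 hc hm hp hpq, ?_⟩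
  simp only
  rw [QuotientGroup.eq]
  simp only [mul_inv_rev, inv_inv, mul_assoc, inv_mul_cancel, mul_one]
  exact H.zpow_mem t.2 m

end NoTripods

/-! ### The Cayley–Abels graph and the conclusion. -/

section Main

variable {G : Type*} [Group G] {H : Subgroup G} {S : Set G}

theorem hasBoundedSection_of_finite_quotient [Finite (G ⧸ H)] : HasBoundedSection H S :=
  ⟨Quotient.out, fun a => by simp,
    Set.range fun p : (G ⧸ H) × (G ⧸ H) => (p.1.out)⁻¹ * p.2.out, Set.finite_range _,
    fun a b _ => ⟨(a, b), rfl⟩⟩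

theorem hasBoundedSection_of_finite [Finite H] (hS : S.Finite) : HasBoundedSection H S := by
  refine ⟨Quotient.out, fun a => by simp, (H : Set G) * (S ∪ S⁻¹) * (H : Set G),
    ((Set.toFinite _).mul (hS.union hS.inv)).mul (Set.toFinite _), fun a b hab => ?_⟩
  obtain ⟨s, hs, h₁, h₂, heq⟩ := exists_doubleCoset_of_adj hab (g := a.out) (k := b.out)
    (by simp) (by simp)
  exact ⟨_, ⟨_, h₁.2, _, hs, rfl⟩, _, h₂.2, heq.symm⟩

theorem cayleyAbelsGraph_adj_or_eq {s : G} (hs : s ∈ S) (g : G) :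
    (g : G ⧸ H) = ((g * s : G) : G ⧸ H) ∨
      (cayleyAbelsGraph H S).Adj (g : G ⧸ H) ((g * s : G) : G ⧸ H) := by
  rw [cayleyAbelsGraph, fromRel_adj, or_iff_not_imp_left]
  exact fun hne => ⟨hne, Or.inl ⟨g, s, hs, rfl, rfl⟩⟩

theorem connected_cayleyAbelsGraph (hS : Subgroup.closure S = ⊤) :
    (cayleyAbelsGraph H S).Connected := by
  have key : ∀ k ∈ Subgroup.closure S, ∀ g : G,
      (cayleyAbelsGraph H S).Reachable (g : G ⧸ H) ((g * k : G) : G ⧸ H) := by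
    intro k hk
    induction hk using Subgroup.closure_induction with
    | mem s hs =>
      intro g
      rcases cayleyAbelsGraph_adj_or_eq (H := H) hs g with h | h
      · rw [← h]
      · exact h.reachable
    | one => intro g; rw [mul_one]
    | mul x y _ _ hx hy => intro g; rw [← mul_assoc]; exact (hx g).trans (hy _)
    | inv x _ hx => intro g; simpa using (hx (g * x⁻¹)).symm
  rw [connected_iff]
  refine ⟨fun a b => ?_, ⟨((1 : G) : G ⧸ H)⟩⟩
  obtain ⟨g, rfl⟩ := QuotientGroup.mk_surjective a
  obtain ⟨k, rfl⟩ := QuotientGroup.mk_surjective b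
  simpa using key (g⁻¹ * k) (hS ▸ trivial) g

theorem exists_dist_cayleyAbelsGraph_le (hS : Subgroup.closure S = ⊤) (k : G) : ∃ N, ∀ g : G,
    (cayleyAbelsGraph H S).dist (g : G ⧸ H) ((g * k : G) : G ⧸ H) ≤ N := by
  have hc := connected_cayleyAbelsGraph (H := H) hS
  have hk : k ∈ Subgroup.closure S := hS ▸ trivial
  induction hk using Subgroup.closure_induction with
  | mem s hs =>
    refine ⟨1, fun g => ?_⟩
    rcases cayleyAbelsGraph_adj_or_eq (H := H) hs g with h | h
    · rw [← h]; simp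
    · rw [dist_eq_one_iff_adj.2 h]
  | one => exact ⟨0, fun g => by simp⟩
  | mul x y _ _ hx hy =>
    obtain ⟨N, hN⟩ := hx
    obtain ⟨M, hM⟩ := hy
    refine ⟨N + M, fun g => ?_⟩
    rw [← mul_assoc]
    exact hc.dist_triangle.trans (Nat.add_le_add (hN g) (hM _))
  | inv x _ hx =>
    obtain ⟨N, hN⟩ := hx
    refine ⟨N, fun g => ?_⟩
    have := hN (g * x⁻¹)
    rw [dist_comm]
    simpa using this

/-- The quotient map and the section are both Lipschitz, and their composite is the identity on `G ⧸
H`, so the retract criterion applies. -/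
theorem HasBoundedSection.isHyperbolic (hσ : HasBoundedSection H S)
    (hS : Subgroup.closure S = ⊤) {S₀ : Set G} {δ : ℕ} (h4 : (mulCayley S₀).FourPoint δ)
    (hS₀ : S₀.Finite) (hc : (mulCayley S₀).Connected) : (cayleyAbelsGraph H S).IsHyperbolic := by
  obtain ⟨σ, hσ, F, hF, hσF⟩ := hσ
  have hcΛ := connected_cayleyAbelsGraph (H := H) hS
  choose N hN using exists_dist_cayleyAbelsGraph_le (H := H) hS
  obtain ⟨L₁, hL₁⟩ := ((finite_wordLength_le hS₀ hc 1).image N).bddAbove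
  obtain ⟨L₂, hL₂⟩ := (hF.image (wordLength S₀)).bddAbove
  refine isHyperbolic_of_retract (L := L₁ + L₂) (f := fun g : G => (g : G ⧸ H)) (g := σ) h4 hc hcΛ
    (fun x y hxy => ?_) (fun a b hab => ?_) (fun a => by simp [hσ])
  · rw [dist_mulCayley] at hxy
    have h1 : N (x⁻¹ * y) ≤ L₁ := hL₁ ⟨_, hxy, rfl⟩
    have h2 := hN (x⁻¹ * y) x
    rw [mul_inv_cancel_left] at h2
    exact h2.trans (h1.trans (Nat.le_add_right _ _))
  · rcases Nat.le_one_iff_eq_zero_or_eq_one.1 hab with h | h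
    · rw [(hcΛ.dist_eq_zero_iff).1 h]; simp
    · have h1 : wordLength S₀ ((σ a)⁻¹ * σ b) ≤ L₂ :=
        hL₂ ⟨_, hσF a b (dist_eq_one_iff_adj.1 h), rfl⟩
      rw [dist_mulCayley]
      omega

end Main

theorem mainTheorem10 {G : Type*} [Group G] (hG : IsHyperbolicGroup G)
    (H : Subgroup G) (hH : IsHyperbolicGroup H) (hcomm : H.IsCommensurated)
    (S : Set G) (hSfin : S.Finite) (hSgen : Subgroup.closure S = ⊤) :
    (cayleyAbelsGraph H S).IsHyperbolic := by
  obtain ⟨S₀, hS₀, -, hc, δ, hδ⟩ := hG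
  obtain ⟨T, hT, -, hcT, δ', hδ'⟩ := hH
  have h4 := hδ.fourPoint hc
  have h4' := hδ'.fourPoint hcT
  refine HasBoundedSection.isHyperbolic ?_ hSgen h4 hS₀ hc
  by_cases htri : ∃ C, ∀ R, ∃ x y z : H, R ≤ wordLength T x ∧ R ≤ wordLength T y ∧
      R ≤ wordLength T z ∧ (mulCayley T).IsCenter C 1 x y z
  · obtain ⟨C, hC⟩ := htri
    exact hasBoundedSection_of_tripods hcomm hSfin h4' hT hcT hC
  · push Not at htri
    rcases finite_or_infinite H with hfin | hinf
    · exact hasBoundedSection_of_finite hSfin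
    · have := finite_quotient_of_no_tripods hcomm h4 hS₀ hc h4' hT hcT hinf htri
      exact hasBoundedSection_of_finite_quotient
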